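/- **Setting.** A Kripke structure $\mathcal K=\langle S,s_{init},\delta,L\rangle$ has a finite state set $S$, a transition relation $\delta$ in which every state has a successor, and a labelling $L:S\to 2^{AP}$. A state is *terminal* (halting) if its only successor is itself. $\mathcal K$ is *acyclic* if its only loops are self-loops on terminal states. Its *maximum depth* is the largest number of transitions that a path from $s_{init}$ takes before it reaches a terminal state. $\mathsf{Traces}(\mathcal K)$ is the set of label sequences of the infinite paths from $s_{init}$. Extended A-HLTL formulas are $\varphi::=\exists\pi.\varphi\mid\forall\pi.\varphi\mid\mathsf E\tau.\varphi\mid\mathsf A\tau.\varphi\mid\psi$ with $\psi::=true\mid a_{\pi,\tau}\mid\neg\psi\mid\psi\vee\psi\mid\psi\wedge\psi\mid\psi\,\mathcal U\,\psi\mid\psi\,\mathcal R\,\psi$. $\varphi$ is *well-formed* if its atoms use quantified variables only and no variable is quantified twice; $\mathsf{Paths}(\varphi)$ and $\mathsf{Trajs}(\varphi)$ are the sets of its trace variables $\pi$ and trajectory variables $\tau$. A *fair trajectory* over a set $D$ of trace variables is a sequence $t(0)t(1)\cdots$ of subsets of $D$ such that every $\pi\in D$ lies in infinitely many $t(j)$.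 A partial map $\Pi$ sends pairs $(\pi,\tau)$ to pointed traces $(\sigma,n)$, and a partial map $\Gamma$ sends each $\tau$ to a trajectory. $(\Pi,\Gamma)+1$ drops the first letter of every $\Gamma(\tau)$ and increments the pointer of $\Pi(\pi,\tau)$ if $\pi\in\Gamma(\tau)(0)$. $\exists\pi$ ($\forall\pi$) selects a trace $\sigma\in\mathsf{Traces}(\mathcal K)$ and sets $\Pi(\pi,\tau)=(\sigma,0)$ for all $\tau$; $\mathsf E\tau$ ($\mathsf A\tau$) selects a fair trajectory over the trace variables assigned by $\Pi$ as $\Gamma(\tau)$; $a_{\pi,\tau}$ holds if $a\in\sigma(n)$ for $(\sigma,n)=\Pi(\pi,\tau)$; the Boolean connectives, $\mathcal U$ and $\mathcal R$ have the usual LTL meaning along $(\Pi,\Gamma)+i$, $i\ge0$. $\mathcal K\models\varphi$ means that $\varphi$ holds when $\Pi,\Gamma$ are empty. **Encoding.** Let $\varphi=\mathbb Q_1\pi_1\cdots\mathbb Q_p\pi_p.\,\mathbb Q'_1\tau_1\cdots\mathbb Q'_r\tau_r.\,\psi$ be well-formed with at most one alternation among the trajectory quantifiers $\mathbb Q'_1\cdots\mathbb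 Q'_r$ (trace quantifiers are arbitrary), and bring $\psi$ into negation normal form. Fix bounds $k,m$ and any injective binary code of $S$. The Boolean variables are: the bits $x_\pi^i$ of the $i$-th state of $\pi$ ($i\le k$), with formulas $I$ (initial state), $R$ (transition), $a_\pi^i$ (proposition $a$ holds) and $halt_\pi^i$ (the state is terminal) over them; $t_{\tau,\pi}^j$ ($j\le m$); $pos_{\pi,\tau}^{i,j}$ and $off_{\pi,\tau}^j$ ($i\le k$, $j\le m+1$). Put $[\![\mathcal K]\!]_k^\pi=I(x_\pi^0)\wedge\bigwedge_{i<k}R(x_\pi^i,x_\pi^{i+1})$, - $setpos_{\pi,\tau}^{i,j}=pos_{\pi,\tau}^{i,j}\wedge\bigwedge_{n\le k,n\ne i}\neg pos_{\pi,\tau}^{n,j}\wedge\neg off_{\pi,\tau}^j$ and $nopos_{\pi,\tau}^j=off_{\pi,\tau}^j\wedge\bigwedge_{n\le k}\neg pos_{\pi,\tau}^{n,j}$; - $\varphi_{pos}=\bigwedge_{\pi,\tau}setpos_{\pi,\tau}^{0,0}\wedge\bigwedge_{j\le m}\bigwedge_{\pi,\tau}(step\wedge stutters\wedge ends)_{\pi,\tau}^j$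 with $step_{\pi,\tau}^j=\bigwedge_{i<k}(pos_{\pi,\tau}^{i,j}\wedge t_{\tau,\pi}^j\to setpos_{\pi,\tau}^{i+1,j+1})$, $stutters_{\pi,\tau}^j=\bigwedge_{i\le k}(pos_{\pi,\tau}^{i,j}\wedge\neg t_{\tau,\pi}^j\to setpos_{\pi,\tau}^{i,j+1})$, $ends_{\pi,\tau}^j=(pos_{\pi,\tau}^{k,j}\wedge t_{\tau,\pi}^j)\to\big((\neg halt_\pi^k\to nopos_{\pi,\tau}^{j+1})\wedge(halt_\pi^k\to setpos_{\pi,\tau}^{k,j+1})\big)$; - $halt_{\pi,\tau}^j=\bigvee_{i\le k}(pos_{\pi,\tau}^{i,j}\wedge halt_\pi^i)$, $halted_U^j=\bigwedge_{\tau\in U}\bigwedge_\pi halt_{\pi,\tau}^j$, $halted^j=halted^j_{\mathsf{Trajs}(\varphi)}$, $off^j=\bigvee_{\pi,\tau}off_{\pi,\tau}^j$, and $moves_U^j=halted_U^j\vee\bigvee_{\tau\in U,\pi}(t_{\tau,\pi}^j\wedge\neg halt_{\pi,\tau}^j)$. The temporal part is translated, for $0\le j\le m$, by $[\![a_{\pi,\tau}]\!]^j=\bigvee_{i\le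 k}(pos_{\pi,\tau}^{i,j}\wedge a_\pi^i)$, $[\![\neg a_{\pi,\tau}]\!]^j=\bigvee_{i\le k}(pos_{\pi,\tau}^{i,j}\wedge\neg a_\pi^i)$, homomorphically for constants, $\vee$ and $\wedge$, and as follows for $\mathcal U$, $\mathcal R$. Let $u^j=[\![\psi_2]\!]^j\vee([\![\psi_1]\!]^j\wedge[\![\psi_1\mathcal U\psi_2]\!]^{j+1})$ and $r^j=[\![\psi_2]\!]^j\wedge([\![\psi_1]\!]^j\vee[\![\psi_1\mathcal R\psi_2]\!]^{j+1})$. - *Halting pessimistic* ($hpes$): for $j<m$, $[\![\psi_1\mathcal U\psi_2]\!]^j=\neg off^j\wedge u^j$ and $[\![\psi_1\mathcal R\psi_2]\!]^j=\neg off^j\wedge r^j$; at $m$, $[\![\psi_1\mathcal U\psi_2]\!]^m=[\![\psi_2]\!]^m$ and $[\![\psi_1\mathcal R\psi_2]\!]^m=([\![\psi_1]\!]^m\wedge[\![\psi_2]\!]^m)\vee(halted^m\wedge[\![\psi_2]\!]^m)$. - *Halting optimistic* ($hopt$): for $j<m$, $[\![\psi_1\mathcal U\psi_2]\!]^j=off^j\vee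 u^j$ and $[\![\psi_1\mathcal R\psi_2]\!]^j=off^j\vee r^j$; at $m$, $[\![\psi_1\mathcal U\psi_2]\!]^m=[\![\psi_2]\!]^m\vee(\neg halted^m\wedge[\![\psi_1]\!]^m)$ and $[\![\psi_1\mathcal R\psi_2]\!]^m=[\![\psi_2]\!]^m$. According to the trajectory prefix, where $U$, $U_A$, $U_E$ are the blocks of trajectory variables and $j$ ranges over $0,\dots,m$, $enc(\psi)$ is - $[\![\psi]\!]^0$ for an empty prefix; $\bigwedge_j moves_U^j\wedge[\![\psi]\!]^0$ for $\mathsf E^+U$; $\bigwedge_j moves_U^j\to[\![\psi]\!]^0$ for $\mathsf A^+U$; - $\bigwedge_j moves_{U_A}^j\to\big(\bigwedge_j(halted_{U_A}^j\to moves_{U_E}^j)\wedge[\![\psi]\!]^0\big)$ for $\mathsf A^+U_A\,\mathsf E^+U_E$; - $\bigwedge_j moves_{U_E}^j\wedge\big(\bigwedge_j(halted_{U_E}^j\to moves_{U_A}^j)\to[\![\psi]\!]^0\big)$ for $\mathsf E^+U_E\,\mathsf A^+U_A$. Finally, for either mode, $[\![\mathcal K,\varphi]\!]_{k,m}$ is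 the QBF $$\mathbb Q_1\overline{x_{\pi_1}}\cdots\mathbb Q_p\overline{x_{\pi_p}}.\,\mathbb Q'_1\overline{t_{\tau_1}}\cdots\mathbb Q'_r\overline{t_{\tau_r}}.\,\exists\overline{pos}.\,\exists\overline{off}.\ \big([\![\mathcal K]\!]_k^{\pi_1}\circ_1(\cdots([\![\mathcal K]\!]_k^{\pi_p}\circ_p(\varphi_{pos}\wedge enc(\psi)))\cdots)\big),$$ where $\mathsf E,\mathsf A$ are read as $\exists,\forall$ over the variables $t_{\tau,\pi}^j$ of $\tau$, and $\circ_i$ is $\wedge$ if $\mathbb Q_i=\exists$ and $\to$ if $\mathbb Q_i=\forall$. **Theorem.** Let $\mathcal K$ be a finite acyclic Kripke structure of maximum depth $K$, let $\varphi$ be a well-formed extended A-HLTL formula of the above form with at most one trajectory-quantifier alternation, and let $M=K\cdot|\mathsf{Paths}(\varphi)|\cdot|\mathsf{Trajs}(\varphi)|$. Then 1. $[\![\mathcal K,\varphi]\!]^{hpes}_{K,M}$ is satisfiable if and only if $\mathcal K\models\varphi$; 2. $[\![\mathcal K,\varphi]\!]^{hopt}_{K,M}$ is satisfiable if and only if $\mathcal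 K\models\varphi$. -/

import Mathlib

namespace AHLTL

universe u v w z

/-! ## Kripke structures -/

/-- A trace over `AP`: an infinite sequence of letters from `2^AP`. -/
abbrev Trace (AP : Type u) := ℕ → Set AP

/-- Kripke structures; every state has a successor. -/
structure Kripke (S : Type u) (AP : Type v) where
  init : S
  rel : S → S → Prop
  label : S → Set AP
  total : ∀ s, ∃ s', rel s s'

namespace Kripke

variable {S : Type u} {AP : Type v} (𝒦 : Kripke S AP)

/-- Infinite paths from the initial state. -/
def IsPath (p : ℕ → S) : Prop :=
  p 0 = 𝒦.init ∧ ∀ i, 𝒦.rel (p i) (p (i + 1))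

/-- The traces of the paths that start in the initial state. -/
def traces : Set (Trace AP) :=
  {σ | ∃ p, 𝒦.IsPath p ∧ ∀ i, σ i = 𝒦.label (p i)}

/-- A terminal (halting) state: no outgoing transition other than the self-loop, which is then
present because every state has a successor. -/
def Terminal (s : S) : Prop := ∀ s', 𝒦.rel s s' → s' = s

/-- Acyclic frame: the only loops are self-loops on terminal states, that is, every state which
lies on a loop is terminal. -/
def Acyclic : Prop := ∀ s, Relation.TransGen 𝒦.rel s s → 𝒦.Terminal s

/-- `K` is the maximum depth: the largest number of transitions that a path takes before it
reaches a terminal state. -/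
def IsMaxDepth (K : ℕ) : Prop :=
  IsGreatest {n | ∃ p, 𝒦.IsPath p ∧ ∀ i < n, ¬ 𝒦.Terminal (p i)} K

instance [FinEnum S] [DecidableRel 𝒦.rel] : DecidablePred 𝒦.Terminal :=
  fun s => inferInstanceAs (Decidable (∀ s', 𝒦.rel s s' → s' = s))

/-- A finite acyclic Kripke structure has a maximum depth. -/
theorem Acyclic.exists_isMaxDepth [Finite S] {𝒦 : Kripke S AP} (h : 𝒦.Acyclic) :
    ∃ K, 𝒦.IsMaxDepth K := by
  classical
  have := Fintype.ofFinite S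
  have hne : {n | ∃ p, 𝒦.IsPath p ∧ ∀ i < n, ¬ 𝒦.Terminal (p i)}.Nonempty := by
    choose f hf using 𝒦.total
    refine ⟨0, fun n => f^[n] 𝒦.init, ⟨rfl, fun i => ?_⟩, by simp⟩
    simp only [Function.iterate_succ_apply']
    exact hf _
  have hbdd : BddAbove {n | ∃ p, 𝒦.IsPath p ∧ ∀ i < n, ¬ 𝒦.Terminal (p i)} := by
    refine ⟨Fintype.card S, ?_⟩
    rintro n ⟨p, ⟨-, hp⟩, hn⟩
    have key : ∀ i d, Relation.TransGen 𝒦.rel (p i) (p (i + d + 1)) := by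
      intro i d
      induction d with
      | zero => exact .single (hp i)
      | succ d ih => exact ih.tail (hp _)
    have hlt : ∀ i j, i < j → i < n → p i ≠ p j := by
      intro i j hij hi he
      obtain ⟨d, rfl⟩ := Nat.exists_eq_add_of_lt hij
      have := key i d
      rw [← he] at this
      exact hn i hi (h _ this)
    have hinj : Function.Injective (fun i : Fin n => p i) := by
      intro i j hij
      by_contra hne
      rcases lt_or_gt_of_ne (fun e => hne (Fin.ext e)) with hl | hl
      · exact hlt _ _ hl i.2 hij
      · exact hlt _ _ hl j.2 hij.symm
    simpa using Fintype.card_le_of_injective _ hinj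
  exact ⟨_, Nat.sSup_mem hne hbdd, fun n hn => le_csSup hbdd hn⟩

end Kripke

/-! ## Syntax -/

inductive Quant where
  | all
  | ex
deriving DecidableEq

/-- The quantifier-free temporal formulas; `atom a π τ` is the atom `a_{π,τ}`. -/
inductive LTL (AP : Type u) (V : Type v) (J : Type w) where
  | tru
  | atom (a : AP) (π : V) (τ : J)
  | neg (ψ : LTL AP V J)
  | or (ψ₁ ψ₂ : LTL AP V J)
  | and (ψ₁ ψ₂ : LTL AP V J)
  | untl (ψ₁ ψ₂ : LTL AP V J)
  | release (ψ₁ ψ₂ : LTL AP V J)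

/-- Extended A-HLTL formulas: `path q π φ` is `∃π.φ` or `∀π.φ`, and `traj q τ φ` is `E τ.φ` or
`A τ.φ`. -/
inductive Formula (AP : Type u) (V : Type v) (J : Type w) where
  | path (q : Quant) (π : V) (φ : Formula AP V J)
  | traj (q : Quant) (τ : J) (φ : Formula AP V J)
  | body (ψ : LTL AP V J)

/-- All atoms `a_{π,τ}` have `π` in `ps` and `τ` in `ts`. -/
def LTL.VarsIn {AP : Type u} {V : Type v} {J : Type w} (ps : List V) (ts : List J) :
    LTL AP V J → Prop
  | .tru => True
  | .atom _ π τ => π ∈ ps ∧ τ ∈ ts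
  | .neg ψ => ψ.VarsIn ps ts
  | .or ψ₁ ψ₂ => ψ₁.VarsIn ps ts ∧ ψ₂.VarsIn ps ts
  | .and ψ₁ ψ₂ => ψ₁.VarsIn ps ts ∧ ψ₂.VarsIn ps ts
  | .untl ψ₁ ψ₂ => ψ₁.VarsIn ps ts ∧ ψ₂.VarsIn ps ts
  | .release ψ₁ ψ₂ => ψ₁.VarsIn ps ts ∧ ψ₂.VarsIn ps ts

namespace Formula

variable {AP : Type u} {V : Type v} {J : Type w}

/-- The trace quantifiers, outermost first. -/
def pathQs : Formula AP V J → List (Quant × V)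
  | .path q π φ => (q, π) :: φ.pathQs
  | .traj _ _ φ => φ.pathQs
  | .body _ => []

/-- The trajectory quantifiers, outermost first. -/
def trajQs : Formula AP V J → List (Quant × J)
  | .path _ _ φ => φ.trajQs
  | .traj q τ φ => (q, τ) :: φ.trajQs
  | .body _ => []

/-- The quantifier-free part. -/
def inner : Formula AP V J → LTL AP V J
  | .path _ _ φ => φ.inner
  | .traj _ _ φ => φ.inner
  | .body ψ => ψ

/-- The quantified trace variables. -/
def paths (φ : Formula AP V J) : List V := φ.pathQs.map Prod.snd

/-- The quantified trajectory variables. -/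
def trajs (φ : Formula AP V J) : List J := φ.trajQs.map Prod.snd

/-- Every atom uses quantified variables only, and no variable is quantified twice. -/
def WellFormed (φ : Formula AP V J) : Prop :=
  φ.paths.Nodup ∧ φ.trajs.Nodup ∧ φ.inner.VarsIn φ.paths φ.trajs

/-- `Q τ₁. … Q τₙ. ψ` -/
def IsTrajPrefix : Formula AP V J → Prop
  | .path _ _ _ => False
  | .traj _ _ φ => φ.IsTrajPrefix
  | .body _ => True

/-- `Q π₁. … Q πₗ. Q τ₁. … Q τₙ. ψ`: all trace quantifiers precede all trajectory quantifiers. -/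
def IsPrenex : Formula AP V J → Prop
  | .path _ _ φ => φ.IsPrenex
  | .traj _ _ φ => φ.IsTrajPrefix
  | .body _ => True

end Formula

/-- The number of quantifier alternations in a quantifier prefix. -/
def alternations : List Quant → ℕ
  | [] => 0
  | [_] => 0
  | q :: q' :: l => (if q = q' then 0 else 1) + alternations (q' :: l)

/-! ## Semantics -/

/-- A trajectory: the set of trace variables that advance, at every step. -/
abbrev Trajectory (V : Type v) := ℕ → Set V

/-- The fair trajectories for the trace variables in `D`. -/
def fairTrajectories {V : Type v} (D : Set V) : Set (Trajectory V) :=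
  {t | (∀ i, t i ⊆ D) ∧ ∀ π ∈ D, ∀ n, ∃ j, n ≤ j ∧ π ∈ t j}

/-- A pair of an asynchronous trace assignment, which maps `(π, τ)` to a pointed trace, and a
trajectory assignment; both are partial. -/
structure Assignment (AP : Type u) (V : Type v) (J : Type w) where
  trace : V → J → Option (Trace AP × ℕ)
  traj : J → Option (Trajectory V)

namespace Assignment

variable {AP : Type u} {V : Type v} {J : Type w}

/-- The assignment that is undefined everywhere. -/
def empty : Assignment AP V J := ⟨fun _ _ => none, fun _ => none⟩

/-- The trace variables to which a trace is assigned. -/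
def dom (A : Assignment AP V J) : Set V := {π | ∃ τ, A.trace π τ ≠ none}

/-- Map `(π, τ)` to `(σ, 0)`, for all `τ`. -/
def setTrace [DecidableEq V] (A : Assignment AP V J) (π : V) (σ : Trace AP) :
    Assignment AP V J :=
  ⟨Function.update A.trace π (fun _ => some (σ, 0)), A.traj⟩

/-- Map `τ` to `t`. -/
def setTraj [DecidableEq J] (A : Assignment AP V J) (τ : J) (t : Trajectory V) :
    Assignment AP V J :=
  ⟨A.trace, Function.update A.traj τ (some t)⟩

open Classical in
/-- The successor `(Π, Γ) + 1`. -/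
noncomputable def succ (A : Assignment AP V J) : Assignment AP V J where
  trace π τ := if ∃ t, A.traj τ = some t ∧ π ∈ t 0
    then (A.trace π τ).map (fun x => (x.1, x.2 + 1)) else A.trace π τ
  traj τ := (A.traj τ).map (fun t i => t (i + 1))

end Assignment

/-- Satisfaction of temporal formulas; `Assignment.succ^[i] A` is `(Π, Γ) + i`. -/
def LTL.Sat {AP : Type u} {V : Type v} {J : Type w} : LTL AP V J → Assignment AP V J → Prop
  | .tru, _ => True
  | .atom a π τ, A => ∃ σ n, A.trace π τ = some (σ, n) ∧ a ∈ σ n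
  | .neg ψ, A => ¬ ψ.Sat A
  | .or ψ₁ ψ₂, A => ψ₁.Sat A ∨ ψ₂.Sat A
  | .and ψ₁ ψ₂, A => ψ₁.Sat A ∧ ψ₂.Sat A
  | .untl ψ₁ ψ₂, A =>
      ∃ i, ψ₂.Sat (Assignment.succ^[i] A) ∧ ∀ j < i, ψ₁.Sat (Assignment.succ^[j] A)
  | .release ψ₁ ψ₂, A =>
      (∀ i, ψ₂.Sat (Assignment.succ^[i] A)) ∨
        ∃ i, ψ₁.Sat (Assignment.succ^[i] A) ∧ ∀ j ≤ i, ψ₂.Sat (Assignment.succ^[j] A)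

/-- Satisfaction of formulas over a set `T` of traces. -/
def Formula.Sat {AP : Type u} {V : Type v} {J : Type w} [DecidableEq V] [DecidableEq J]
    (T : Set (Trace AP)) : Formula AP V J → Assignment AP V J → Prop
  | .path .ex π φ, A => ∃ σ ∈ T, φ.Sat T (A.setTrace π σ)
  | .path .all π φ, A => ∀ σ ∈ T, φ.Sat T (A.setTrace π σ)
  | .traj .ex τ φ, A => ∃ t ∈ fairTrajectories A.dom, φ.Sat T (A.setTraj τ t)
  | .traj .all τ φ, A => ∀ t ∈ fairTrajectories A.dom, φ.Sat T (A.setTraj τ t)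
  | .body ψ, A => ψ.Sat A

/-- `𝒦 ⊨ φ` -/
def Kripke.Models {S : Type z} {AP : Type u} {V : Type v} {J : Type w} [DecidableEq V]
    [DecidableEq J] (𝒦 : Kripke S AP) (φ : Formula AP V J) : Prop :=
  φ.Sat 𝒦.traces Assignment.empty

/-! ## Quantified Boolean formulas -/

/-- Propositional formulas with variables in `X`. -/
inductive PropForm (X : Type u) where
  | tru
  | var (x : X)
  | neg (f : PropForm X)
  | and (f g : PropForm X)
  | or (f g : PropForm X)

namespace PropForm

variable {X : Type u}

def fls : PropForm X := .neg .tru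

def imp (f g : PropForm X) : PropForm X := .or (.neg f) g

/-- The conjunction of `f a` over `a` in a list. -/
def conj {ι : Type v} (l : List ι) (f : ι → PropForm X) : PropForm X :=
  l.foldr (fun a g => .and (f a) g) .tru

/-- The disjunction of `f a` over `a` in a list. -/
def disj {ι : Type v} (l : List ι) (f : ι → PropForm X) : PropForm X :=
  l.foldr (fun a g => .or (f a) g) fls

def eval (v : X → Bool) : PropForm X → Bool
  | .tru => true
  | .var x => v x
  | .neg f => !(f.eval v)
  | .and f g => f.eval v && g.eval v
  | .or f g => f.eval v || g.eval v

end PropForm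

/-- Prenex quantified Boolean formulas with variables in `X`. -/
inductive QBF (X : Type u) where
  | quant (q : Quant) (x : X) (Φ : QBF X)
  | matrix (f : PropForm X)

namespace QBF

variable {X : Type u}

def eval [DecidableEq X] : QBF X → (X → Bool) → Bool
  | .quant .all x Φ, v => Φ.eval (Function.update v x false) && Φ.eval (Function.update v x true)
  | .quant .ex x Φ, v => Φ.eval (Function.update v x false) || Φ.eval (Function.update v x true)
  | .matrix f, v => f.eval v

/-- Some assignment of the free variables makes the formula true. -/
def Satisfiable [DecidableEq X] (Φ : QBF X) : Prop := ∃ v, Φ.eval v = true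

/-- Quantify a list of variables. -/
def block (q : Quant) (l : List X) (Φ : QBF X) : QBF X := l.foldr (.quant q) Φ

end QBF

/-! ## The encoding -/

/-- Temporal formulas in negation normal form; `lit true a π τ` is `a_{π,τ}` and
`lit false a π τ` is `¬ a_{π,τ}`. -/
inductive NNF (AP : Type u) (V : Type v) (J : Type w) where
  | const (b : Bool)
  | lit (b : Bool) (a : AP) (π : V) (τ : J)
  | or (ψ₁ ψ₂ : NNF AP V J)
  | and (ψ₁ ψ₂ : NNF AP V J)
  | untl (ψ₁ ψ₂ : NNF AP V J)
  | release (ψ₁ ψ₂ : NNF AP V J)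

/-- `ψ.toNNF true` is the negation normal form of `ψ`, and `ψ.toNNF false` that of `¬ ψ`. -/
def LTL.toNNF {AP : Type u} {V : Type v} {J : Type w} : LTL AP V J → Bool → NNF AP V J
  | .tru, b => .const b
  | .atom a π τ, b => .lit b a π τ
  | .neg ψ, b => ψ.toNNF (!b)
  | .or ψ₁ ψ₂, true => .or (ψ₁.toNNF true) (ψ₂.toNNF true)
  | .or ψ₁ ψ₂, false => .and (ψ₁.toNNF false) (ψ₂.toNNF false)
  | .and ψ₁ ψ₂, true => .and (ψ₁.toNNF true) (ψ₂.toNNF true)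
  | .and ψ₁ ψ₂, false => .or (ψ₁.toNNF false) (ψ₂.toNNF false)
  | .untl ψ₁ ψ₂, true => .untl (ψ₁.toNNF true) (ψ₂.toNNF true)
  | .untl ψ₁ ψ₂, false => .release (ψ₁.toNNF false) (ψ₂.toNNF false)
  | .release ψ₁ ψ₂, true => .release (ψ₁.toNNF true) (ψ₂.toNNF true)
  | .release ψ₁ ψ₂, false => .untl (ψ₁.toNNF false) (ψ₂.toNNF false)

/-- The Boolean variables of the encoding: bit `b` of the `i`-th state of the path `π`; whether
the trajectory `τ` moves `π` at step `j`; whether `π` has been moved by `τ` to position `i` after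
`j` steps; and whether `π` has fallen off its unrolling after `j` steps of `τ`. -/
inductive BVar (V : Type u) (J : Type v) (B : Type w) where
  | x (π : V) (i : ℕ) (b : B)
  | t (τ : J) (π : V) (j : ℕ)
  | pos (π : V) (τ : J) (i j : ℕ)
  | off (π : V) (τ : J) (j : ℕ)
deriving DecidableEq

/-- The two ways of looking beyond the bounds: halting pessimistic and halting optimistic. -/
inductive Mode where
  | hpes
  | hopt

namespace Encoding

open PropForm

section System

/-! The encoding of the states, in terms of an injective binary code of the states. -/

variable {S AP V J B : Type*} [FinEnum S] [FinEnum B] (𝒦 : Kripke S AP) (code : S ↪ (B → Bool))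

/-- The `i`-th state of the path `π` is `s`. -/
def stateIs (π : V) (i : ℕ) (s : S) : PropForm (BVar V J B) :=
  conj (FinEnum.toList B) fun b =>
    if code s b then .var (.x π i b) else .neg (.var (.x π i b))

/-- The `i`-th state of the path `π` satisfies `P`. -/
def stateIn (P : S → Prop) [DecidablePred P] (π : V) (i : ℕ) : PropForm (BVar V J B) :=
  disj ((FinEnum.toList S).filter (fun s => decide (P s))) (stateIs code π i)

/-- The initial condition. -/
def initF (π : V) : PropForm (BVar V J B) := stateIs code π 0 𝒦.init

/-- The transition relation between the states `i` and `i + 1` of the path `π`. -/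
def transF [DecidableRel 𝒦.rel] (π : V) (i : ℕ) : PropForm (BVar V J B) :=
  disj (FinEnum.toList S) fun s => .and (stateIs code π i s) (stateIn code (𝒦.rel s) π (i + 1))

/-- The unrolling of the structure up to depth `k`. -/
def unrollF [DecidableRel 𝒦.rel] (k : ℕ) (π : V) : PropForm (BVar V J B) :=
  .and (initF 𝒦 code π) (conj (List.range k) (transF 𝒦 code π))

/-- The proposition `a` holds in the `i`-th state of the path `π`. -/
def propF [∀ a, DecidablePred fun s => a ∈ 𝒦.label s] (a : AP) (π : V) (i : ℕ) :
    PropForm (BVar V J B) :=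
  stateIn code (fun s => a ∈ 𝒦.label s) π i

/-- The `i`-th state of the path `π` is a halting state. -/
def haltF [DecidableRel 𝒦.rel] (π : V) (i : ℕ) : PropForm (BVar V J B) :=
  stateIn code 𝒦.Terminal π i

end System

section Positions

/-! The encoding of positions. Here `ps` and `ts` are the quantified trace and trajectory
variables, `k` and `m` are the bounds, and `halt π i` says that state `i` of `π` is halting. -/

variable {V J B : Type*} (ps : List V) (ts : List J) (k m : ℕ)
  (halt : V → ℕ → PropForm (BVar V J B))

def tF (τ : J) (π : V) (j : ℕ) : PropForm (BVar V J B) := .var (.t τ π j)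

def posF (π : V) (τ : J) (i j : ℕ) : PropForm (BVar V J B) := .var (.pos π τ i j)

def offF (π : V) (τ : J) (j : ℕ) : PropForm (BVar V J B) := .var (.off π τ j)

def setpos (π : V) (τ : J) (i j : ℕ) : PropForm (BVar V J B) :=
  .and (posF π τ i j)
    (.and (conj ((List.range (k + 1)).filter (fun n => n ≠ i)) fun n => .neg (posF π τ n j))
      (.neg (offF π τ j)))

def nopos (π : V) (τ : J) (j : ℕ) : PropForm (BVar V J B) :=
  .and (offF π τ j) (conj (List.range (k + 1)) fun n => .neg (posF π τ n j))

def step (π : V) (τ : J) (j : ℕ) : PropForm (BVar V J B) :=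
  conj (List.range k) fun i =>
    imp (.and (posF π τ i j) (tF τ π j)) (setpos k π τ (i + 1) (j + 1))

def stutters (π : V) (τ : J) (j : ℕ) : PropForm (BVar V J B) :=
  conj (List.range (k + 1)) fun i =>
    imp (.and (posF π τ i j) (.neg (tF τ π j))) (setpos k π τ i (j + 1))

def ends (π : V) (τ : J) (j : ℕ) : PropForm (BVar V J B) :=
  imp (.and (posF π τ k j) (tF τ π j))
    (.and (imp (.neg (halt π k)) (nopos k π τ (j + 1)))
      (imp (halt π k) (setpos k π τ k (j + 1))))

/-- All paths are initially at position `0`. -/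
def initPos : PropForm (BVar V J B) :=
  conj ps fun π => conj ts fun τ => setpos k π τ 0 0

/-- The correct assignment of the position variables. -/
def phiPos : PropForm (BVar V J B) :=
  .and (initPos ps ts k)
    (conj (List.range (m + 1)) fun j => conj ps fun π => conj ts fun τ =>
      .and (step k π τ j) (.and (stutters k π τ j) (ends k halt π τ j)))

/-- The path `π` has reached a halting state after `j` steps of `τ`. -/
def haltAt (π : V) (τ : J) (j : ℕ) : PropForm (BVar V J B) :=
  disj (List.range (k + 1)) fun i => .and (posF π τ i j) (halt π i)

/-- All paths have reached a halting state after `j` steps of all trajectories in `U`. -/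
def halted (U : List J) (j : ℕ) : PropForm (BVar V J B) :=
  conj U fun τ => conj ps fun π => haltAt k halt π τ j

/-- Some path has fallen off its unrolling. -/
def offAny (j : ℕ) : PropForm (BVar V J B) :=
  disj ps fun π => disj ts fun τ => offF π τ j

/-- All paths have halted according to `U`, or a trajectory in `U` moves a non-halted path. -/
def moves (U : List J) (j : ℕ) : PropForm (BVar V J B) :=
  .or (halted ps k halt U j)
    (disj U fun τ => disj ps fun π => .and (tF τ π j) (.neg (haltAt k halt π τ j)))

/-- The encoding of until at step `j` with `n` steps left to the bound `j + n`, where `f` and `g`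
encode the two arguments. -/
def untlF (mode : Mode) (f g : ℕ → PropForm (BVar V J B)) : ℕ → ℕ → PropForm (BVar V J B)
  | 0, j =>
    match mode with
    | .hpes => g j
    | .hopt => .or (g j) (.and (.neg (halted ps k halt ts j)) (f j))
  | n + 1, j =>
    let r := .or (g j) (.and (f j) (untlF mode f g n (j + 1)))
    match mode with
    | .hpes => .and (.neg (offAny ps ts j)) r
    | .hopt => .or (offAny ps ts j) r

/-- The encoding of release at step `j` with `n` steps left to the bound `j + n`, where `f` and
`g` encode the two arguments. -/
def releaseF (mode : Mode) (f g : ℕ → PropForm (BVar V J B)) : ℕ → ℕ → PropForm (BVar V J B)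
  | 0, j =>
    match mode with
    | .hpes => .or (.and (f j) (g j)) (.and (halted ps k halt ts j) (g j))
    | .hopt => g j
  | n + 1, j =>
    let r := .and (g j) (.or (f j) (releaseF mode f g n (j + 1)))
    match mode with
    | .hpes => .and (.neg (offAny ps ts j)) r
    | .hopt => .or (offAny ps ts j) r

/-- The encoding of a temporal formula at step `j ≤ m`; `prop a π i` says that `a` holds in
state `i` of `π`. -/
def ltlF {AP : Type*} (prop : AP → V → ℕ → PropForm (BVar V J B)) (mode : Mode) :
    NNF AP V J → ℕ → PropForm (BVar V J B)
  | .const true, _ => .tru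
  | .const false, _ => fls
  | .lit true a π τ, j =>
    disj (List.range (k + 1)) fun i => .and (posF π τ i j) (prop a π i)
  | .lit false a π τ, j =>
    disj (List.range (k + 1)) fun i => .and (posF π τ i j) (.neg (prop a π i))
  | .or ψ₁ ψ₂, j => .or (ltlF prop mode ψ₁ j) (ltlF prop mode ψ₂ j)
  | .and ψ₁ ψ₂, j => .and (ltlF prop mode ψ₁ j) (ltlF prop mode ψ₂ j)
  | .untl ψ₁ ψ₂, j =>
    untlF ps ts k halt mode (ltlF prop mode ψ₁) (ltlF prop mode ψ₂) (m - j) j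
  | .release ψ₁ ψ₂, j =>
    releaseF ps ts k halt mode (ltlF prop mode ψ₁) (ltlF prop mode ψ₂) (m - j) j

/-- All steps up to the bound move `U`. -/
def allMove (U : List J) : PropForm (BVar V J B) :=
  conj (List.range (m + 1)) (moves ps k halt U)

/-- All steps up to the bound at which `U₁` has halted move `U₂`. -/
def allMoveAfter (U₁ U₂ : List J) : PropForm (BVar V J B) :=
  conj (List.range (m + 1)) fun j => imp (halted ps k halt U₁ j) (moves ps k halt U₂ j)

/-- The encoding of the temporal formula relative to a prefix of trajectory quantifiers with at
most one alternation, which consists of an outer block `U₁` with quantifier `q` and a (possibly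
empty) inner block `U₂` with the other quantifier; `f` encodes the temporal formula at step
`0`. -/
def enc (tq : List (Quant × J)) (f : PropForm (BVar V J B)) : PropForm (BVar V J B) :=
  match tq with
  | [] => f
  | (q, τ) :: l =>
    let U₁ := τ :: (l.takeWhile (fun p => p.1 = q)).map Prod.snd
    let U₂ := (l.dropWhile (fun p => p.1 = q)).map Prod.snd
    match q, U₂ with
    | .ex, [] => .and (allMove ps k m halt U₁) f
    | .all, [] => imp (allMove ps k m halt U₁) f
    | .all, _ :: _ =>
      imp (allMove ps k m halt U₁) (.and (allMoveAfter ps k m halt U₁ U₂) f)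
    | .ex, _ :: _ =>
      .and (allMove ps k m halt U₁) (imp (allMoveAfter ps k m halt U₁ U₂) f)

end Positions

section Combine

variable {S AP V J B : Type*} [FinEnum S] [FinEnum B] (𝒦 : Kripke S AP) [DecidableRel 𝒦.rel]
  [∀ a, DecidablePred fun s => a ∈ 𝒦.label s] (code : S ↪ (B → Bool)) (φ : Formula AP V J)
  (mode : Mode) (k m : ℕ)

/-- The propositional part of the encoding. -/
def matrixF : PropForm (BVar V J B) :=
  φ.pathQs.foldr
    (fun p f =>
      match p.1 with
      | .all => imp (unrollF 𝒦 code k p.2) f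
      | .ex => .and (unrollF 𝒦 code k p.2) f)
    (.and (phiPos φ.paths φ.trajs k m (haltF 𝒦 code))
      (enc φ.paths k m (haltF 𝒦 code) φ.trajQs
        (ltlF φ.paths φ.trajs k m (haltF 𝒦 code) (propF 𝒦 code) mode (φ.inner.toNNF true) 0)))

def xVars (B : Type*) [FinEnum B] (V J : Type*) (k : ℕ) (π : V) : List (BVar V J B) :=
  (List.range (k + 1)).flatMap fun i => (FinEnum.toList B).map fun b => .x π i b

def tVars (B : Type*) (ps : List V) (m : ℕ) (τ : J) : List (BVar V J B) :=
  ps.flatMap fun π => (List.range (m + 1)).map fun j => .t τ π j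

/-- The position variables; the position formula refers to step `m + 1`. -/
def posVars (B : Type*) (ps : List V) (ts : List J) (k m : ℕ) : List (BVar V J B) :=
  ps.flatMap fun π => ts.flatMap fun τ => (List.range (k + 1)).flatMap fun i =>
    (List.range (m + 2)).map fun j => .pos π τ i j

def offVars (B : Type*) (ps : List V) (ts : List J) (m : ℕ) : List (BVar V J B) :=
  ps.flatMap fun π => ts.flatMap fun τ => (List.range (m + 2)).map fun j => .off π τ j

/-- The QBF encoding of the structure and the formula with bounds `k` and `m`. -/
def qbf : QBF (BVar V J B) :=
  φ.pathQs.foldr (fun p Φ => QBF.block p.1 (xVars B V J k p.2) Φ)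
    (φ.trajQs.foldr (fun p Φ => QBF.block p.1 (tVars B φ.paths m p.2) Φ)
      (QBF.block .ex (posVars B φ.paths φ.trajs k m)
        (QBF.block .ex (offVars B φ.paths φ.trajs m)
          (.matrix (matrixF 𝒦 code φ mode k m)))))

end Combine

end Encoding

end AHLTL

/-! In an acyclic structure of maximum depth `K` every path is constant from some depth `d π ≤ K`
on. The letter seen by an atom after `n` steps of a trajectory therefore depends only on the
`position`, the number of moves made so far capped at `d π`. Positions only grow, and once every
path sits at its cap nothing changes any more.

Two facts make bounded trajectories suffice. Temporal formulas are invariant under stuttering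
(`LTL.holds_count`), so a step that moves no unhalted path may be deleted or inserted. If no such
step remains before halting, every step raises the sum of all positions, which is at most `K` times
the number of pairs of a path and a trajectory (`allHalted_of_moves`). A finite prefix extended by
moving everything forever is conversely a fair trajectory (`boolTraj`).

With one alternation, the two blocks share a clock. When the outer block is compressed, an inner
choice is pulled back by inserting stuttering steps. An inner block is compressed only after the
first step at which the outer block has halted: earlier steps stay synchronised, later deletions
cannot affect the outer positions. Hence inner moves are demanded only after the outer block has
halted, and the two halting times add up to at most `M` (`exists_forall_fair_iff`). The prefix
`A⁺E⁺` follows by negation.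

At these bounds no path falls off its unrolling, and under the move conditions all paths have halted
at step `M`. Both modes then collapse to the argument `ψ₂` at `M`, and below `M` they unfold the
fixpoint equations of until and release, so they are exact (`eval_ltlF_iff_holds`). The position
variables are determined by the other variables (`quantUpd_pos_iff`).

To compare the quantifiers, those of the QBF and the trajectory quantifiers are both written as
`quantUpd`, where blocks merge into a single choice of a function. The trace quantifiers are handled
by induction on the formula (`sat_iff_quantUpd_prefix`): a valuation of the state bits that
satisfies the unrolling encodes a path, and the unrolling guards commute with the later quantifiers.
-/

namespace AHLTL

/-! ### Evaluation of propositional formulas -/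

namespace PropForm

variable {X : Type*} (v : X → Bool)

@[simp] theorem eval_tru : (tru : PropForm X).eval v = true := rfl

@[simp] theorem eval_fls : (fls : PropForm X).eval v = false := rfl

@[simp] theorem eval_var (x : X) : (var x).eval v = v x := rfl

@[simp] theorem eval_neg (f : PropForm X) : (neg f).eval v = !f.eval v := rfl

@[simp] theorem eval_and (f g : PropForm X) : (and f g).eval v = (f.eval v && g.eval v) := rfl

@[simp] theorem eval_or (f g : PropForm X) : (or f g).eval v = (f.eval v || g.eval v) := rfl

@[simp] theorem eval_imp (f g : PropForm X) :
    (imp f g).eval v = true ↔ (f.eval v = true → g.eval v = true) := by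
  simp only [imp, eval_or, eval_neg]
  cases f.eval v <;> simp

@[simp] theorem eval_conj {ι : Type*} (l : List ι) (f : ι → PropForm X) :
    (conj l f).eval v = true ↔ ∀ a ∈ l, (f a).eval v = true := by
  induction l with
  | nil => simp [conj]
  | cons a l ih =>
    have : conj (a :: l) f = and (f a) (conj l f) := rfl
    simp [this, ih]

@[simp] theorem eval_disj {ι : Type*} (l : List ι) (f : ι → PropForm X) :
    (disj l f).eval v = true ↔ ∃ a ∈ l, (f a).eval v = true := by
  induction l with
  | nil => simp [disj]
  | cons a l ih =>
    have : disj (a :: l) f = or (f a) (disj l f) := rfl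
    simp [this, ih]

end PropForm

/-! ## Quantification by successive updates -/

/-- Quantify successively over the values at the points of a list, the values being restricted
by `C`. -/
def quantUpd {X Y : Type*} [DecidableEq X] (C : Y → Prop) :
    List (Quant × X) → ((X → Y) → Prop) → (X → Y) → Prop
  | [], F, g => F g
  | (.ex, x) :: l, F, g => ∃ y, C y ∧ quantUpd C l F (Function.update g x y)
  | (.all, x) :: l, F, g => ∀ y, C y → quantUpd C l F (Function.update g x y)

section quantUpd

variable {X Y : Type*} [DecidableEq X] {C : Y → Prop}

def Quant.dual : Quant → Quant
  | .all => .ex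
  | .ex => .all

theorem Quant.ne_iff_eq_dual {q q' : Quant} : q' ≠ q ↔ q' = q.dual := by
  cases q <;> cases q' <;> simp [dual]

/-- De Morgan through the prefix. Universal blocks, implications and the prefix `A⁺E⁺` are all
reduced to their existential counterparts by it. -/
theorem quantUpd_dual (l : List (Quant × X)) (F : (X → Y) → Prop) (g : X → Y) :
    quantUpd C (l.map fun p => (p.1.dual, p.2)) (fun g => ¬ F g) g ↔ ¬ quantUpd C l F g := by
  induction l generalizing g with
  | nil => rfl
  | cons p l ih =>
    obtain ⟨q, x⟩ := p
    have ih' := fun y => ih (Function.update g x y)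
    cases q
    · simp only [List.map_cons, quantUpd, show Quant.all.dual = Quant.ex from rfl, ih']
      push Not
      rfl
    · simp only [List.map_cons, quantUpd, show Quant.ex.dual = Quant.all from rfl, ih']
      push Not
      rfl

theorem quantUpd_append (l l' : List (Quant × X)) (F : (X → Y) → Prop) (g : X → Y) :
    quantUpd C (l ++ l') F g ↔ quantUpd C l (quantUpd C l' F) g := by
  induction l generalizing g with
  | nil => rfl
  | cons p l ih =>
    obtain ⟨q, x⟩ := p
    cases q <;> simp [quantUpd, ih]

/-- A block of existential quantifiers. -/
theorem quantUpd_ex_block (U : List X) (F : (X → Y) → Prop) (g : X → Y) :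
    quantUpd C (U.map fun x => (.ex, x)) F g ↔
      ∃ g', (∀ x ∉ U, g' x = g x) ∧ (∀ x ∈ U, C (g' x)) ∧ F g' := by
  induction U generalizing g with
  | nil =>
    simp only [List.map_nil, quantUpd, List.not_mem_nil, not_false_eq_true, forall_const,
      IsEmpty.forall_iff]
    exact ⟨fun h => ⟨g, fun _ => rfl, fun _ => trivial, h⟩, fun ⟨g', h, _, h'⟩ => funext h ▸ h'⟩
  | cons x U ih =>
    simp only [List.map_cons, quantUpd, ih, List.mem_cons, not_or, and_imp, forall_eq_or_imp]
    constructor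
    · rintro ⟨y, hy, g', h₁, h₂, h₃⟩
      refine ⟨g', fun z hz hz' => by rw [h₁ z hz', Function.update_of_ne hz], ⟨?_, h₂⟩, h₃⟩
      -- The list may contain `x` again, in which case a later update decides its value.
      by_cases hx : x ∈ U
      · exact h₂ x hx
      · rw [h₁ x hx, Function.update_self]
        exact hy
    · rintro ⟨g', h₁, ⟨h₂, h₃⟩, h₄⟩
      refine ⟨g' x, h₂, g', fun z hz => ?_, h₃, h₄⟩
      by_cases hzx : z = x
      · subst hzx
        simp
      · rw [Function.update_of_ne hzx, h₁ z hzx hz]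

/-- A block of universal quantifiers. -/
theorem quantUpd_all_block (U : List X) (F : (X → Y) → Prop) (g : X → Y) :
    quantUpd C (U.map fun x => (.all, x)) F g ↔
      ∀ g', (∀ x ∉ U, g' x = g x) → (∀ x ∈ U, C (g' x)) → F g' := by
  have := quantUpd_dual (C := C) (U.map fun x => (Quant.all, x)) F g
  rw [← not_iff_not, ← this, List.map_map]
  refine (quantUpd_ex_block U _ g).trans ?_
  push Not
  rfl

/-- Later quantifiers do not touch what `u` depends on. Some value must satisfy `C`, for otherwise a
universal quantifier would be vacuous and lose the guard. -/
theorem quantUpd_and (hC : ∃ y, C y) (l : List (Quant × X)) (u F : (X → Y) → Prop) (g : X → Y)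
    (hu : ∀ p ∈ l, ∀ g y, u (Function.update g p.2 y) ↔ u g) :
    quantUpd C l (fun g => u g ∧ F g) g ↔ u g ∧ quantUpd C l F g := by
  obtain ⟨y₀, hy₀⟩ := hC
  induction l generalizing g with
  | nil => rfl
  | cons p l ih =>
    obtain ⟨q, x⟩ := p
    have h := hu (q, x) (by simp)
    have h' := fun g => ih g fun p hp => hu p (by simp [hp])
    cases q
    · simp only [quantUpd, h', h]
      exact ⟨fun H => ⟨(H y₀ hy₀).1, fun y hy => (H y hy).2⟩, fun H y hy => ⟨H.1, H.2 y hy⟩⟩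
    · simp only [quantUpd, h', h]
      tauto

theorem quantUpd_imp (hC : ∃ y, C y) (l : List (Quant × X)) (u F : (X → Y) → Prop) (g : X → Y)
    (hu : ∀ p ∈ l, ∀ g y, u (Function.update g p.2 y) ↔ u g) :
    quantUpd C l (fun g => u g → F g) g ↔ (u g → quantUpd C l F g) := by
  have := quantUpd_and hC (l.map fun p => (p.1.dual, p.2)) u (fun g => ¬ F g) g
    (by simp only [List.mem_map]; rintro _ ⟨p, hp, rfl⟩; exact hu p hp)
  rw [quantUpd_dual, ← not_iff_not] at this
  rw [← not_iff_not, ← quantUpd_dual]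
  simp only [Classical.not_imp]
  rw [← not_iff_not, this]

end quantUpd

/-! ### Quantified Boolean formulas as iterated quantification over updates -/

namespace QBF

variable {X : Type*} [DecidableEq X]

theorem eval_quant (q : Quant) (x : X) (Φ : QBF X) (v : X → Bool) :
    (quant q x Φ).eval v = true ↔
      quantUpd (fun _ => True) [(q, x)] (fun v => Φ.eval v = true) v := by
  cases q <;> simp [eval, quantUpd, Bool.forall_bool, Bool.exists_bool]

theorem eval_block (q : Quant) (l : List X) (Φ : QBF X) (v : X → Bool) :
    (block q l Φ).eval v = true ↔
      quantUpd (fun _ => True) (l.map fun x => (q, x)) (fun v => Φ.eval v = true) v := by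
  induction l generalizing v with
  | nil => rfl
  | cons x l ih =>
    have : block q (x :: l) Φ = quant q x (block q l Φ) := rfl
    rw [this, eval_quant, List.map_cons,
      show (q, x) :: l.map (fun x => (q, x)) = [(q, x)] ++ l.map (fun x => (q, x)) from rfl,
      quantUpd_append]
    simp only [ih]

theorem eval_foldr_block {ι : Type*} (L : List (Quant × ι)) (vars : ι → List X) (Φ : QBF X)
    (v : X → Bool) :
    (L.foldr (fun p Φ => block p.1 (vars p.2) Φ) Φ).eval v = true ↔
      quantUpd (fun _ => True) (L.flatMap fun p => (vars p.2).map fun x => (p.1, x))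
        (fun v => Φ.eval v = true) v := by
  induction L generalizing v with
  | nil => rfl
  | cons p L ih =>
    rw [List.foldr_cons, eval_block, List.flatMap_cons, quantUpd_append]
    simp only [ih]

end QBF

/-! ## Until and release on predicates of time -/

/-- Absolute times rather than offsets are used, so that time can be reindexed when stuttering steps
are removed. -/
def UntilAt (p q : ℕ → Prop) (n : ℕ) : Prop := ∃ i, n ≤ i ∧ q i ∧ ∀ j, n ≤ j → j < i → p j

/-- Being the dual of until by definition, release inherits each fact about until by negation. -/
def ReleaseAt (p q : ℕ → Prop) (n : ℕ) : Prop := ¬ UntilAt (fun i => ¬ p i) (fun i => ¬ q i) n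

theorem untilAt_rec (p q : ℕ → Prop) (n : ℕ) :
    UntilAt p q n ↔ q n ∨ (p n ∧ UntilAt p q (n + 1)) := by
  constructor
  · rintro ⟨i, hi, hq, hp⟩
    rcases hi.eq_or_lt with rfl | hi
    · exact .inl hq
    · exact .inr ⟨hp n le_rfl hi, i, hi, hq, fun j hj => hp j (by omega)⟩
  · rintro (h | ⟨h, i, hi, hq, hp⟩)
    · exact ⟨n, le_rfl, h, fun j h h' => by omega⟩
    · refine ⟨i, by omega, hq, fun j hj hji => ?_⟩
      rcases hj.eq_or_lt with rfl | hj
      · exact h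
      · exact hp j hj hji

theorem releaseAt_rec (p q : ℕ → Prop) (n : ℕ) :
    ReleaseAt p q n ↔ q n ∧ (p n ∨ ReleaseAt p q (n + 1)) := by
  rw [ReleaseAt, untilAt_rec, ReleaseAt]
  tauto

theorem untilAt_of_const (p q : ℕ → Prop) (n : ℕ) (h : ∀ i, n ≤ i → (q i ↔ q n)) :
    UntilAt p q n ↔ q n :=
  ⟨fun ⟨i, hi, hq, _⟩ => (h i hi).1 hq, fun hq => ⟨n, le_rfl, hq, fun j h h' => by omega⟩⟩

theorem releaseAt_of_const (p q : ℕ → Prop) (n : ℕ) (h : ∀ i, n ≤ i → (q i ↔ q n)) :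
    ReleaseAt p q n ↔ q n := by
  rw [ReleaseAt, untilAt_of_const _ _ _ fun i hi => not_congr (h i hi), not_not]

/-- The value after the stuttering steps, those outside `e`, are removed. -/
theorem untilAt_count {e : ℕ → Prop} [DecidablePred e] (he : {n | e n}.Infinite)
    {p q p' q' : ℕ → Prop} (hp : ∀ n, p n ↔ p' (Nat.count e n))
    (hq : ∀ n, q n ↔ q' (Nat.count e n)) (n : ℕ) :
    UntilAt p q n ↔ UntilAt p' q' (Nat.count e n) := by
  have hsurj : ∀ j', Nat.count e n ≤ j' → ∃ j, n ≤ j ∧ Nat.count e j = j' := by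
    intro j' hj'
    by_cases h : n ≤ Nat.nth e j'
    · exact ⟨_, h, Nat.count_nth_of_infinite he j'⟩
    · refine ⟨n, le_rfl, hj'.antisymm ?_⟩
      have hnth : Nat.count e (Nat.nth e j') = j' := Nat.count_nth_of_infinite he j'
      exact hnth.symm.le.trans (Nat.count_monotone e (not_le.1 h).le)
  constructor
  · rintro ⟨i, hi, hqi, hpi⟩
    refine ⟨_, Nat.count_monotone e hi, (hq i).1 hqi, fun j' hj' hji => ?_⟩
    obtain ⟨j, hj, rfl⟩ := hsurj j' hj'
    refine (hp j).1 (hpi j hj ?_)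
    by_contra hc
    exact absurd (Nat.count_monotone e (not_lt.1 hc)) (not_le.2 hji)
  · rintro ⟨i', hi', hqi, hpi⟩
    -- The witness is the first time from `n` on whose count is `i'`: all earlier ones from `n` on
    -- then have a strictly smaller count.
    have hex := hsurj i' hi'
    classical
    obtain ⟨h₁, h₂⟩ := Nat.find_spec hex
    refine ⟨Nat.find hex, h₁, (hq _).2 (h₂.symm ▸ hqi), fun j hj hji => (hp j).2 (hpi _
      (Nat.count_monotone e hj) ?_)⟩
    refine lt_of_le_of_ne (h₂ ▸ Nat.count_monotone e hji.le) fun h => ?_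
    exact Nat.find_min hex hji ⟨hj, h⟩

theorem releaseAt_count {e : ℕ → Prop} [DecidablePred e] (he : {n | e n}.Infinite)
    {p q p' q' : ℕ → Prop} (hp : ∀ n, p n ↔ p' (Nat.count e n))
    (hq : ∀ n, q n ↔ q' (Nat.count e n)) (n : ℕ) :
    ReleaseAt p q n ↔ ReleaseAt p' q' (Nat.count e n) :=
  not_congr (untilAt_count he (fun n => not_congr (hp n)) (fun n => not_congr (hq n)) n)

theorem exists_add_iff_untilAt (p q : ℕ → Prop) (n : ℕ) :
    (∃ i, q (i + n) ∧ ∀ j < i, p (j + n)) ↔ UntilAt p q n := by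
  constructor
  · rintro ⟨i, hq, hp⟩
    refine ⟨i + n, by omega, hq, fun j hj hji => ?_⟩
    have := hp (j - n) (by omega)
    rwa [Nat.sub_add_cancel hj] at this
  · rintro ⟨i, hi, hq, hp⟩
    refine ⟨i - n, by rwa [Nat.sub_add_cancel hi], fun j hj => hp _ (by omega) (by omega)⟩

theorem forall_or_exists_add_iff_releaseAt (p q : ℕ → Prop) (n : ℕ) :
    ((∀ i, q (i + n)) ∨ ∃ i, p (i + n) ∧ ∀ j ≤ i, q (j + n)) ↔ ReleaseAt p q n := by
  rw [ReleaseAt, ← exists_add_iff_untilAt]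
  constructor
  · rintro (h | ⟨i, hp, hq⟩) ⟨i', hq', hp'⟩
    · exact hq' (h i')
    · rcases lt_or_ge i i' with hi | hi
      · exact hp' i hi hp
      · exact hq' (hq i' hi)
  · intro h
    push Not at h
    by_cases hall : ∀ i, q (i + n)
    · exact .inl hall
    · push Not at hall
      classical
      obtain ⟨j, hj, hpj⟩ := h _ (Nat.find_spec hall)
      exact .inr ⟨j, hpj, fun i hi => not_not.1 (Nat.find_min hall (hi.trans_lt hj))⟩

/-! ## Temporal formulas over a valuation of the atoms at every time -/

namespace LTL

variable {AP V J : Type*}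

def Holds (lab : ℕ → AP → V → J → Prop) : LTL AP V J → ℕ → Prop
  | .tru, _ => True
  | .atom a π τ, n => lab n a π τ
  | .neg ψ, n => ¬ ψ.Holds lab n
  | .or ψ₁ ψ₂, n => ψ₁.Holds lab n ∨ ψ₂.Holds lab n
  | .and ψ₁ ψ₂, n => ψ₁.Holds lab n ∧ ψ₂.Holds lab n
  | .untl ψ₁ ψ₂, n => UntilAt (ψ₁.Holds lab) (ψ₂.Holds lab) n
  | .release ψ₁ ψ₂, n => ReleaseAt (ψ₁.Holds lab) (ψ₂.Holds lab) n

/-- This separates the temporal operators from the assignments: afterwards only the sequence of atom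
valuations matters. -/
theorem sat_iterate_iff_holds {lab : ℕ → AP → V → J → Prop} {A : Assignment AP V J}
    {ps : List V} {ts : List J}
    (hlab : ∀ n a, ∀ π ∈ ps, ∀ τ ∈ ts,
      (LTL.atom a π τ).Sat (Assignment.succ^[n] A) ↔ lab n a π τ)
    (ψ : LTL AP V J) (hψ : ψ.VarsIn ps ts) (n : ℕ) :
    ψ.Sat (Assignment.succ^[n] A) ↔ ψ.Holds lab n := by
  induction ψ generalizing n with
  | tru => exact Iff.rfl
  | atom a π τ => exact hlab n a π hψ.1 τ hψ.2
  | neg ψ ih => exact not_congr (ih hψ n)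
  | or ψ₁ ψ₂ ih₁ ih₂ => exact or_congr (ih₁ hψ.1 n) (ih₂ hψ.2 n)
  | and ψ₁ ψ₂ ih₁ ih₂ => exact and_congr (ih₁ hψ.1 n) (ih₂ hψ.2 n)
  | untl ψ₁ ψ₂ ih₁ ih₂ =>
    simp only [Sat, ← Function.iterate_add_apply, ih₁ hψ.1, ih₂ hψ.2]
    exact exists_add_iff_untilAt _ _ n
  | release ψ₁ ψ₂ ih₁ ih₂ =>
    simp only [Sat, ← Function.iterate_add_apply, ih₁ hψ.1, ih₂ hψ.2]
    exact forall_or_exists_add_iff_releaseAt _ _ n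

/-- Invariance under stuttering. -/
theorem holds_count {e : ℕ → Prop} [DecidablePred e] (he : {n | e n}.Infinite)
    {lab lab' : ℕ → AP → V → J → Prop} (h : ∀ n, lab n = lab' (Nat.count e n))
    (ψ : LTL AP V J) (n : ℕ) : ψ.Holds lab n ↔ ψ.Holds lab' (Nat.count e n) := by
  induction ψ generalizing n with
  | tru => exact Iff.rfl
  | atom a π τ => simp only [Holds, h]
  | neg ψ ih => exact not_congr (ih n)
  | or ψ₁ ψ₂ ih₁ ih₂ => exact or_congr (ih₁ n) (ih₂ n)
  | and ψ₁ ψ₂ ih₁ ih₂ => exact and_congr (ih₁ n) (ih₂ n)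
  | untl ψ₁ ψ₂ ih₁ ih₂ => exact untilAt_count he ih₁ ih₂ n
  | release ψ₁ ψ₂ ih₁ ih₂ => exact releaseAt_count he ih₁ ih₂ n

/-- On a constant suffix until and release both reduce to their second argument, so constancy of the
atoms propagates through the formula. This is what licenses cutting the evaluation off at `m`. -/
theorem holds_of_const {lab : ℕ → AP → V → J → Prop} {m : ℕ} (h : ∀ n, m ≤ n → lab n = lab m)
    (ψ : LTL AP V J) (n : ℕ) (hn : m ≤ n) : ψ.Holds lab n ↔ ψ.Holds lab m := by
  induction ψ generalizing n with
  | tru => exact Iff.rfl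
  | atom a π τ => simp only [Holds, h n hn]
  | neg ψ ih => exact not_congr (ih n hn)
  | or ψ₁ ψ₂ ih₁ ih₂ => exact or_congr (ih₁ n hn) (ih₂ n hn)
  | and ψ₁ ψ₂ ih₁ ih₂ => exact and_congr (ih₁ n hn) (ih₂ n hn)
  | untl ψ₁ ψ₂ ih₁ ih₂ =>
    simp only [Holds]
    rw [untilAt_of_const _ _ m ih₂, untilAt_of_const, ih₂ n hn]
    exact fun i hi => (ih₂ i (hn.trans hi)).trans (ih₂ n hn).symm
  | release ψ₁ ψ₂ ih₁ ih₂ =>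
    simp only [Holds]
    rw [releaseAt_of_const _ _ m ih₂, releaseAt_of_const, ih₂ n hn]
    exact fun i hi => (ih₂ i (hn.trans hi)).trans (ih₂ n hn).symm

end LTL

/-! ## The encoding of temporal formulas once everything has halted -/

namespace Encoding

variable {AP V J B : Type*} {ps : List V} {ts : List J} {k m : ℕ}
  {halt : V → ℕ → PropForm (BVar V J B)} {v : BVar V J B → Bool}

/-- With the `off` disjuncts false, one unfolding of the encoding is the fixpoint equation. At `m`
the halting condition turns the base case of either mode into the second argument, which is the
exact value since that argument is constant from `m` on. -/
theorem eval_untlF (hoff : ∀ j ≤ m, (offAny ps ts j).eval v = false)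
    (hhalt : (halted ps k halt ts m).eval v = true) (mode : Mode)
    {f g : ℕ → PropForm (BVar V J B)} {F G : ℕ → Prop}
    (hf : ∀ j ≤ m, (f j).eval v = true ↔ F j) (hg : ∀ j ≤ m, (g j).eval v = true ↔ G j)
    (hG : ∀ i, m ≤ i → (G i ↔ G m)) (n j : ℕ) (hnj : j + n = m) :
    (untlF ps ts k halt mode f g n j).eval v = true ↔ UntilAt F G j := by
  induction n generalizing j with
  | zero =>
    obtain rfl : j = m := hnj
    rw [untilAt_of_const _ _ _ hG, ← hg j le_rfl]
    cases mode <;> simp [untlF, hhalt]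
  | succ n ih =>
    rw [untilAt_rec, ← hg j (by omega), ← hf j (by omega), ← ih (j + 1) (by omega)]
    cases mode <;> simp [untlF, hoff j (by omega)]

theorem eval_releaseF (hoff : ∀ j ≤ m, (offAny ps ts j).eval v = false)
    (hhalt : (halted ps k halt ts m).eval v = true) (mode : Mode)
    {f g : ℕ → PropForm (BVar V J B)} {F G : ℕ → Prop}
    (hf : ∀ j ≤ m, (f j).eval v = true ↔ F j) (hg : ∀ j ≤ m, (g j).eval v = true ↔ G j)
    (hG : ∀ i, m ≤ i → (G i ↔ G m)) (n j : ℕ) (hnj : j + n = m) :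
    (releaseF ps ts k halt mode f g n j).eval v = true ↔ ReleaseAt F G j := by
  induction n generalizing j with
  | zero =>
    obtain rfl : j = m := hnj
    rw [releaseAt_of_const _ _ _ hG, ← hg j le_rfl]
    cases mode
    · simp only [releaseF, PropForm.eval_or, PropForm.eval_and, hhalt]
      cases (f j).eval v <;> simp
    · rfl
  | succ n ih =>
    rw [releaseAt_rec, ← hg j (by omega), ← hf j (by omega), ← ih (j + 1) (by omega)]
    cases mode <;> simp [releaseF, hoff j (by omega)]

/-- The polarity `b` is carried through the induction because negation normal form exchanges until
and release. The literals are assumed correct in one mode only, as their encoding is the same in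
both. -/
theorem eval_ltlF {prop : AP → V → ℕ → PropForm (BVar V J B)}
    {lab : ℕ → AP → V → J → Prop} (hoff : ∀ j ≤ m, (offAny ps ts j).eval v = false)
    (hhalt : (halted ps k halt ts m).eval v = true)
    (hconst : ∀ n, m ≤ n → lab n = lab m)
    (hlit : ∀ j ≤ m, ∀ b a, ∀ π ∈ ps, ∀ τ ∈ ts,
      (ltlF ps ts k m halt prop .hpes (.lit b a π τ) j).eval v = true ↔
        (lab j a π τ ↔ b = true))
    (mode : Mode) (ψ : LTL AP V J) (hψ : ψ.VarsIn ps ts) (b : Bool) (j : ℕ) (hj : j ≤ m) :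
    (ltlF ps ts k m halt prop mode (ψ.toNNF b) j).eval v = true ↔
      (ψ.Holds lab j ↔ b = true) := by
  induction ψ generalizing b j with
  | tru => cases b <;> simp [LTL.toNNF, ltlF, LTL.Holds]
  | atom a π τ =>
    have := hlit j hj b a π hψ.1 τ hψ.2
    cases b <;> exact this
  | neg ψ ih =>
    rw [LTL.toNNF, ih hψ _ j hj, LTL.Holds]
    cases b <;> simp
  | or ψ₁ ψ₂ ih₁ ih₂ =>
    cases b <;> simp [LTL.toNNF, ltlF, LTL.Holds, ih₁ hψ.1 _ j hj, ih₂ hψ.2 _ j hj]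
  | and ψ₁ ψ₂ ih₁ ih₂ =>
    cases b <;> simp [LTL.toNNF, ltlF, LTL.Holds, ih₁ hψ.1 _ j hj, ih₂ hψ.2 _ j hj]
    tauto
  | untl ψ₁ ψ₂ ih₁ ih₂ =>
    have hG := LTL.holds_of_const hconst ψ₂
    cases b
    · rw [LTL.toNNF, ltlF, eval_releaseF (F := fun i => ¬ ψ₁.Holds lab i)
        (G := fun i => ¬ ψ₂.Holds lab i) hoff hhalt mode
        (fun j hj => by simpa using ih₁ hψ.1 false j hj)
        (fun j hj => by simpa using ih₂ hψ.2 false j hj)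
        (fun i hi => not_congr (hG i hi)) _ _ (by omega)]
      simp [ReleaseAt, LTL.Holds]
    · rw [LTL.toNNF, ltlF, eval_untlF hoff hhalt mode
        (fun j hj => by simpa using ih₁ hψ.1 true j hj)
        (fun j hj => by simpa using ih₂ hψ.2 true j hj) hG _ _ (by omega)]
      simp [LTL.Holds]
  | release ψ₁ ψ₂ ih₁ ih₂ =>
    have hG := LTL.holds_of_const hconst ψ₂
    cases b
    · rw [LTL.toNNF, ltlF, eval_untlF (F := fun i => ¬ ψ₁.Holds lab i)
        (G := fun i => ¬ ψ₂.Holds lab i) hoff hhalt mode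
        (fun j hj => by simpa using ih₁ hψ.1 false j hj)
        (fun j hj => by simpa using ih₂ hψ.2 false j hj)
        (fun i hi => not_congr (hG i hi)) _ _ (by omega)]
      simp [ReleaseAt, LTL.Holds]
    · rw [LTL.toNNF, ltlF, eval_releaseF hoff hhalt mode
        (fun j hj => by simpa using ih₁ hψ.1 true j hj)
        (fun j hj => by simpa using ih₂ hψ.2 true j hj) hG _ _ (by omega)]
      simp [LTL.Holds]

end Encoding

/-! ## Positions along trajectories -/

section Position

variable {V J : Type*} (d : V → ℕ)

open Classical in
/-- The position of `π` after `n` steps of `t`, capped at the depth `d π`. -/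
noncomputable def position (t : Trajectory V) (n : ℕ) (π : V) : ℕ :=
  min (d π) (Nat.count (fun i => π ∈ t i) n)

theorem position_le (t : Trajectory V) (n : ℕ) (π : V) : position d t n π ≤ d π :=
  min_le_left _ _

@[simp] theorem position_zero (t : Trajectory V) (π : V) : position d t 0 π = 0 := by
  simp [position]

theorem position_succ_of_mem {t : Trajectory V} {n : ℕ} {π : V} (h : π ∈ t n) :
    position d t (n + 1) π = min (d π) (position d t n π + 1) := by
  simp only [position, Nat.count_succ, h, if_true]
  omega

theorem position_succ_of_notMem {t : Trajectory V} {n : ℕ} {π : V} (h : π ∉ t n) :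
    position d t (n + 1) π = position d t n π := by
  simp [position, Nat.count_succ, h]

open Classical in
theorem position_mono (t : Trajectory V) (π : V) : Monotone fun n => position d t n π :=
  fun _ _ h => min_le_min_left _ (Nat.count_monotone _ h)

theorem position_congr {t t' : Trajectory V} {n : ℕ} {π : V}
    (h : ∀ i < n, (π ∈ t i ↔ π ∈ t' i)) : position d t n π = position d t' n π := by
  induction n with
  | zero => simp
  | succ n ih =>
    have ih := ih fun i hi => h i (by omega)
    by_cases hn : π ∈ t n
    · rw [position_succ_of_mem d hn, position_succ_of_mem d ((h n (by omega)).1 hn), ih]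
    · rw [position_succ_of_notMem d hn,
        position_succ_of_notMem d (fun h' => hn ((h n (by omega)).2 h')), ih]

variable (ps : List V)

def AllHalted (T : J → Trajectory V) (U : List J) (n : ℕ) : Prop :=
  ∀ τ ∈ U, ∀ π ∈ ps, position d (T τ) n π = d π

def Moves (T : J → Trajectory V) (U : List J) (n : ℕ) : Prop :=
  AllHalted d ps T U n ∨ ∃ τ ∈ U, ∃ π ∈ ps, π ∈ T τ n ∧ position d (T τ) n π ≠ d π

variable {d ps}

theorem AllHalted.mono {T : J → Trajectory V} {U : List J} {n n' : ℕ}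
    (h : AllHalted d ps T U n) (hn : n ≤ n') : AllHalted d ps T U n' := fun τ hτ π hπ =>
  (position_le d _ _ _).antisymm ((h τ hτ π hπ).symm.le.trans (position_mono d (T τ) π hn))

/-- As long as `U` moves at every step, it halts within as many steps as it can move. -/
theorem allHalted_of_moves {K : ℕ} (hd : ∀ π ∈ ps, d π ≤ K) {T : J → Trajectory V} {U : List J}
    {h : ℕ} (hm : ∀ j, h ≤ j → Moves d ps T U j) :
    AllHalted d ps T U (h + K * ps.length * U.length) := by
  set total : ℕ → ℕ := fun n =>
    (U.map fun τ => (ps.map fun π => position d (T τ) n π).sum).sum with htotal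
  -- The sum of all positions is the potential: a step that moves an unhalted path raises it by at
  -- least one.
  have hlow : ∀ i, ¬ AllHalted d ps T U (h + i) → i ≤ total (h + i) := by
    intro i
    induction i with
    | zero => simp
    | succ i ih =>
      intro hi
      have hni : ¬ AllHalted d ps T U (h + i) := fun hc => hi (hc.mono (by omega))
      refine (Nat.succ_le_succ (ih hni)).trans (Nat.succ_le_of_lt ?_)
      obtain ⟨τ, hτ, π, hπ, hmem, hne⟩ := (hm (h + i) (by omega)).resolve_left hni
      refine List.sum_lt_sum _ _ (fun τ _ => List.sum_le_sum fun π _ =>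
        position_mono d (T τ) π (by omega)) ⟨τ, hτ, List.sum_lt_sum _ _ (fun π _ =>
        position_mono d (T τ) π (by omega)) ⟨π, hπ, ?_⟩⟩
      have := position_succ_of_mem d hmem
      have := position_le d (T τ) (h + i) π
      rw [← add_assoc]
      omega
  by_contra hc
  have h₁ := hlow _ hc
  -- If some path were still below its depth at the bound, the sum would be strictly less than `K`
  -- for each pair, against the lower bound just obtained.
  have h₂ : total (h + K * ps.length * U.length) <
      (U.map fun _ => (ps.map fun _ => K).sum).sum := by
    simp only [AllHalted] at hc
    push Not at hc
    obtain ⟨τ, hτ, π, hπ, hne⟩ := hc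
    refine List.sum_lt_sum _ _ (fun τ _ => List.sum_le_sum fun π hπ =>
      (position_le d _ _ _).trans (hd π hπ)) ⟨τ, hτ, List.sum_lt_sum _ _ (fun π hπ =>
      (position_le d _ _ _).trans (hd π hπ)) ⟨π, hπ, ?_⟩⟩
    exact (lt_of_le_of_ne (position_le d _ _ _) hne).trans_le (hd π hπ)
  simp only [List.map_const', List.sum_replicate, smul_eq_mul] at h₂
  have : U.length * (ps.length * K) = K * ps.length * U.length := by ring
  omega

theorem eventually_position_eq {D : Set V} {t : Trajectory V} (ht : t ∈ fairTrajectories D) {π : V}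
    (hπ : π ∈ D) : ∀ᶠ n in Filter.atTop, position d t n π = d π := by
  -- By fairness `π` moves once more after any given time, so the position eventually reaches any
  -- `c` up to the cap.
  have key : ∀ c, ∃ N, min (d π) c ≤ position d t N π := by
    intro c
    induction c with
    | zero => exact ⟨0, by simp⟩
    | succ c ih =>
      obtain ⟨N, hN⟩ := ih
      obtain ⟨j, hj, hmem⟩ := ht.2 π hπ N
      refine ⟨j + 1, ?_⟩
      have := position_mono d t π hj
      have := position_succ_of_mem d hmem
      simp only at *
      omega
  obtain ⟨N, hN⟩ := key (d π)
  refine Filter.eventually_atTop.2 ⟨N, fun n hn => (position_le d _ _ _).antisymm ?_⟩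
  exact (by simpa using hN : d π ≤ _).trans (position_mono d t π hn)

theorem eventually_allHalted {T : J → Trajectory V} {U : List J}
    (hT : ∀ τ ∈ U, T τ ∈ fairTrajectories {π | π ∈ ps}) :
    ∀ᶠ n in Filter.atTop, AllHalted d ps T U n := by
  refine (Filter.eventually_all_finite (List.finite_toSet U)).2 fun τ hτ => ?_
  exact (Filter.eventually_all_finite (List.finite_toSet ps)).2 fun π hπ =>
    eventually_position_eq (hT τ hτ) hπ

open Classical in
/-- Insert stuttering steps at the steps outside `e`. -/
theorem position_stutter {e : ℕ → Prop} (t : Trajectory V) (n : ℕ) (π : V) :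
    position d (fun n => if e n then t (Nat.count e n) else ∅) n π =
      position d t (Nat.count e n) π := by
  induction n with
  | zero => simp
  | succ n ih =>
    by_cases he : e n
    · rw [Nat.count_succ, if_pos he]
      by_cases hπ : π ∈ t (Nat.count e n)
      · rw [position_succ_of_mem d hπ, position_succ_of_mem d (by simpa [he] using hπ), ih]
      · rw [position_succ_of_notMem d hπ, position_succ_of_notMem d (by simpa [he] using hπ), ih]
    · rw [Nat.count_succ, if_neg he, position_succ_of_notMem d (by simp [he]), ih, add_zero]

open Classical in
theorem stutter_mem_fairTrajectories {e : ℕ → Prop} (he : {n | e n}.Infinite) {D : Set V}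
    {t : Trajectory V} (ht : t ∈ fairTrajectories D) :
    (fun n => if e n then t (Nat.count e n) else ∅) ∈ fairTrajectories D := by
  refine ⟨fun i => ?_, fun π hπ n => ?_⟩
  · by_cases h : e i
    · simpa [h] using ht.1 _
    · simp [h]
  · obtain ⟨j, hj, hmem⟩ := ht.2 π hπ n
    refine ⟨Nat.nth e j, hj.trans (Nat.nth_strictMono he).le_apply, ?_⟩
    simpa [Nat.nth_mem_of_infinite he, Nat.count_nth_of_infinite he] using hmem

open Classical in
/-- Remove all steps from `h` on that do not move `U`. -/
theorem exists_compression {T : J → Trajectory V} {U : List J} (h : ℕ)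
    (hT : ∀ τ ∈ U, T τ ∈ fairTrajectories {π | π ∈ ps}) :
    ∃ (e : ℕ → Prop) (T' : J → Trajectory V), {n | e n}.Infinite ∧
      (∀ n ≤ h, Nat.count e n = n) ∧ (∀ n, h ≤ n → h ≤ Nat.count e n) ∧
      (∀ τ ∈ U, ∀ π ∈ ps, ∀ n, position d (T τ) n π = position d (T' τ) (Nat.count e n) π) ∧
      ∀ j, h ≤ j → Moves d ps T' U j := by
  -- The retained steps: all before `h`, and later those that move an unhalted path or at which all
  -- have halted. The last clause makes `e` infinite, since fairness forces eventual halting.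
  obtain ⟨e, he⟩ : ∃ e : ℕ → Prop, ∀ n, e n ↔ n < h ∨ Moves d ps T U n := ⟨_, fun _ => Iff.rfl⟩
  have hinf : {n | e n}.Infinite := by
    obtain ⟨N, hN⟩ := Filter.eventually_atTop.1 (eventually_allHalted (d := d) hT)
    exact (Set.Ici_infinite N).mono fun n hn => (he n).2 (.inr (.inl (hN n hn)))
  have hcount : ∀ n ≤ h, Nat.count e n = n := by
    intro n
    induction n with
    | zero => simp
    | succ n ih =>
      intro hn
      rw [Nat.count_succ, ih (by omega), if_pos ((he n).2 (.inl (by omega)))]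
  have hcount' : ∀ n, h ≤ n → h ≤ Nat.count e n := fun n hn =>
    (hcount h le_rfl).symm.le.trans (Nat.count_monotone e hn)
  have hpos : ∀ τ ∈ U, ∀ π ∈ ps, ∀ n, position d (T τ) n π =
      position d (fun j => T τ (Nat.nth e j)) (Nat.count e n) π := by
    intro τ hτ π hπ n
    induction n with
    | zero => simp
    | succ n ih =>
      by_cases hen : e n
      · rw [Nat.count_succ, if_pos hen]
        have hnth := Nat.nth_count hen
        by_cases hmem : π ∈ T τ n
        · rw [position_succ_of_mem d hmem, position_succ_of_mem d (by rwa [hnth]), ih]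
        · rw [position_succ_of_notMem d hmem, position_succ_of_notMem d (by rwa [hnth]), ih]
      -- A deleted step can only advance paths that are already at their cap.
      · rw [Nat.count_succ, if_neg hen, add_zero, ← ih]
        by_cases hmem : π ∈ T τ n
        · have hd : position d (T τ) n π = d π := by
            by_contra hne
            exact hen ((he n).2 (.inr (.inr ⟨τ, hτ, π, hπ, hmem, hne⟩)))
          rw [position_succ_of_mem d hmem, hd]
          omega
        · rw [position_succ_of_notMem d hmem]
  refine ⟨e, fun τ j => T τ (Nat.nth e j), hinf, hcount, hcount', hpos, fun j hj => ?_⟩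
  have hj' := Nat.count_nth_of_infinite hinf j
  rcases (he _).1 (Nat.nth_mem_of_infinite hinf j) with hlt | hmv | ⟨τ, hτ, π, hπ, hmem, hne⟩
  -- A retained step before `h` has index below `h`, contrary to `h ≤ j`.
  · rw [hcount _ hlt.le] at hj'
    omega
  · refine .inl fun τ hτ π hπ => ?_
    rw [← hmv τ hτ π hπ, hpos τ hτ π hπ, hj']
  · refine .inr ⟨τ, hτ, π, hπ, hmem, ?_⟩
    rwa [hpos τ hτ π hπ, hj'] at hne

end Position

/-! ## Bounded trajectories given by Boolean variables -/

namespace Encoding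

variable {V J B : Type*} {d : V → ℕ} {ps : List V} {M : ℕ}

theorem mem_tVars {τ : J} {x : BVar V J B} :
    x ∈ tVars B ps M τ ↔ ∃ π ∈ ps, ∃ j ≤ M, x = .t τ π j := by
  simp only [tVars, List.mem_flatMap, List.mem_map, List.mem_range, Nat.lt_succ_iff, eq_comm]

variable (ps M) in
/-- The trajectories given by the variables `t` up to step `M`; after that, everything moves. -/
def boolTraj (w : BVar V J B → Bool) (τ : J) : Trajectory V :=
  fun n => {π | π ∈ ps ∧ (n ≤ M → w (.t τ π n) = true)}

theorem boolTraj_mem_fairTrajectories (w : BVar V J B → Bool) (τ : J) :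
    boolTraj ps M w τ ∈ fairTrajectories {π | π ∈ ps} :=
  ⟨fun _ _ h => h.1, fun _ hπ n => ⟨n + M + 1, by omega, hπ, fun h => by omega⟩⟩

theorem boolTraj_congr {w w' : BVar V J B → Bool} {U : List J}
    (h : ∀ x ∉ U.flatMap (tVars B ps M), w' x = w x) {τ : J} (hτ : τ ∉ U) :
    boolTraj ps M w' τ = boolTraj ps M w τ := by
  funext n
  ext π
  simp only [boolTraj, Set.mem_ofPred_eq]
  rw [h]
  simp only [List.mem_flatMap, mem_tVars, not_exists, not_and]
  rintro τ' hτ' π' _ j _ heq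
  cases heq
  exact hτ hτ'

theorem exists_boolTraj (w : BVar V J B → Bool) (T : J → Trajectory V) (U : List J) :
    ∃ w', (∀ x ∉ U.flatMap (tVars B ps M), w' x = w x) ∧
      ∀ τ ∈ U, ∀ π ∈ ps, ∀ n ≤ M, (π ∈ boolTraj ps M w' τ n ↔ π ∈ T τ n) := by
  classical
  refine ⟨fun x => if x ∈ U.flatMap (tVars B ps M) then
    (match x with | .t τ π n => decide (π ∈ T τ n) | _ => true) else w x,
    fun x hx => if_neg hx, fun τ hτ π hπ n hn => ?_⟩
  have : BVar.t τ π n ∈ U.flatMap (tVars B ps M) :=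
    List.mem_flatMap.2 ⟨τ, hτ, mem_tVars.2 ⟨π, hπ, n, hn, rfl⟩⟩
  simp only [boolTraj, Set.mem_ofPred_eq, if_pos this, decide_eq_true_eq, hπ, hn, true_and,
    forall_const]

/-- Since everything moves beyond `M`, move conditions that the encoding can only state up to `M`
hold at all times as soon as they hold there. -/
theorem moves_boolTraj_of_le {w : BVar V J B → Bool} {U : List J} {j : ℕ} (hj : M < j) :
    Moves d ps (boolTraj ps M w) U j := by
  by_cases h : AllHalted d ps (boolTraj ps M w) U j
  · exact .inl h
  · simp only [AllHalted] at h
    push Not at h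
    obtain ⟨τ, hτ, π, hπ, hne⟩ := h
    exact .inr ⟨τ, hτ, π, hπ, ⟨hπ, fun h => by omega⟩, hne⟩

section Agree

variable {w : BVar V J B → Bool} {T : J → Trajectory V} {U : List J}
  (hw : ∀ τ ∈ U, ∀ π ∈ ps, ∀ n ≤ M, (π ∈ boolTraj ps M w τ n ↔ π ∈ T τ n))
  (hT : AllHalted d ps T U M)

include hw hT

/-- Agreement of the moves up to `M` is enough: by then both trajectories have brought each path to
its cap, where it stays. -/
theorem position_boolTraj {τ : J} (hτ : τ ∈ U) {π : V} (hπ : π ∈ ps) (n : ℕ) :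
    position d (boolTraj ps M w τ) n π = position d (T τ) n π := by
  have hle : ∀ n ≤ M, position d (boolTraj ps M w τ) n π = position d (T τ) n π :=
    fun n hn => position_congr d fun i hi => hw τ hτ π hπ i (by omega)
  rcases le_total n M with hn | hn
  · exact hle n hn
  · refine Eq.trans ?_ (hT.mono hn τ hτ π hπ).symm
    refine (position_le d _ _ _).antisymm ?_
    rw [← hT τ hτ π hπ, ← hle M le_rfl]
    exact position_mono d _ π hn

theorem moves_boolTraj {j : ℕ} (hm : Moves d ps T U j) : Moves d ps (boolTraj ps M w) U j := by
  rcases lt_or_ge M j with hj | hj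
  · exact moves_boolTraj_of_le hj
  rcases hm with hh | ⟨τ, hτ, π, hπ, hmem, hne⟩
  · exact .inl fun τ hτ π hπ => (position_boolTraj hw hT hτ hπ j).trans (hh τ hτ π hπ)
  · refine .inr ⟨τ, hτ, π, hπ, (hw τ hτ π hπ j hj).2 hmem, ?_⟩
    rwa [position_boolTraj hw hT hτ hπ]

end Agree

open Classical in
/-- For properties invariant under stuttering, the quantifiers over fair trajectories can be
restricted to bounded trajectories that move at every step; those of the inner block have to
move only once the outer block has halted. -/
theorem exists_forall_fair_iff {K : ℕ} (hd : ∀ π ∈ ps, d π ≤ K) {U₁ U₂ : List J}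
    (hU : ∀ τ ∈ U₁, τ ∉ U₂)
    (hM : K * ps.length * U₁.length + K * ps.length * U₂.length ≤ M)
    {H : (J → Trajectory V) → Prop}
    (hH : ∀ (e : ℕ → Prop) (T T' : J → Trajectory V), {n | e n}.Infinite →
      (∀ τ, τ ∈ U₁ ∨ τ ∈ U₂ → ∀ π ∈ ps, ∀ n,
        position d (T τ) n π = position d (T' τ) (Nat.count e n) π) → (H T ↔ H T'))
    (w : BVar V J B → Bool) :
    (∃ T₁ : J → Trajectory V, (∀ τ ∈ U₁, T₁ τ ∈ fairTrajectories {π | π ∈ ps}) ∧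
      ∀ T₂ : J → Trajectory V, (∀ τ ∈ U₁, T₂ τ = T₁ τ) →
        (∀ τ ∈ U₂, T₂ τ ∈ fairTrajectories {π | π ∈ ps}) → H T₂) ↔
    ∃ w₁ : BVar V J B → Bool, (∀ x ∉ U₁.flatMap (tVars B ps M), w₁ x = w x) ∧
      ∀ w₂ : BVar V J B → Bool, (∀ x ∉ U₂.flatMap (tVars B ps M), w₂ x = w₁ x) →
        (∀ j, Moves d ps (boolTraj ps M w₂) U₁ j) ∧
        ((∀ j, AllHalted d ps (boolTraj ps M w₂) U₁ j → Moves d ps (boolTraj ps M w₂) U₂ j) →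
          H (boolTraj ps M w₂)) := by
  constructor
  · rintro ⟨T₁, hT₁, hT₂⟩
    -- The outer block is compressed from the start; nothing chosen earlier has to stay synchronised
    -- with it.
    obtain ⟨e, T', he, -, -, hpos, hmov⟩ := exists_compression (d := d) 0 hT₁
    have hhalt : AllHalted d ps T' U₁ M :=
      (allHalted_of_moves hd hmov).mono (by omega)
    obtain ⟨w₁, hw₁, hw₁'⟩ := exists_boolTraj (ps := ps) (M := M) w T' U₁
    refine ⟨w₁, hw₁, fun w₂ hw₂ => ?_⟩
    have heq : ∀ τ ∈ U₁, boolTraj ps M w₂ τ = boolTraj ps M w₁ τ :=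
      fun τ hτ => boolTraj_congr hw₂ (hU τ hτ)
    have hw₂' : ∀ τ ∈ U₁, ∀ π ∈ ps, ∀ n ≤ M, (π ∈ boolTraj ps M w₂ τ n ↔ π ∈ T' τ n) :=
      fun τ hτ => (heq τ hτ).symm ▸ hw₁' τ hτ
    refine ⟨fun j => moves_boolTraj hw₂' hhalt (hmov j (Nat.zero_le _)), fun _ => ?_⟩
    -- The bounded inner choice is answered on the original time scale: the outer block keeps its
    -- uncompressed trajectories, and the inner ones stutter at exactly the deleted steps.
    refine (hH e (fun τ => if τ ∈ U₁ then T₁ τ else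
      fun n => if e n then boolTraj ps M w₂ τ (Nat.count e n) else ∅) _ he ?_).1
      (hT₂ _ (fun τ hτ => if_pos hτ) fun τ hτ => ?_)
    · intro τ _ π hπ n
      by_cases hτ : τ ∈ U₁
      · simp only [hτ, if_true]
        rw [hpos τ hτ π hπ, position_boolTraj hw₂' hhalt hτ hπ]
      · simp only [hτ, if_false]
        exact position_stutter _ n π
    · have hτ' : τ ∉ U₁ := fun h => hU τ h hτ
      simp only [hτ', if_false]
      exact stutter_mem_fairTrajectories he (boolTraj_mem_fairTrajectories w₂ τ)
  · rintro ⟨w₁, -, hw₁⟩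
    refine ⟨boolTraj ps M w₁, fun τ _ => boolTraj_mem_fairTrajectories w₁ τ,
      fun T₂ hT₂ hfair => ?_⟩
    have hmov₁ : ∀ j, Moves d ps (boolTraj ps M w₁) U₁ j := (hw₁ w₁ fun _ _ => rfl).1
    have hhalt₁ := allHalted_of_moves hd (h := 0) fun j _ => hmov₁ j
    -- The first time at which the outer block has halted. The inner block is compressed only from
    -- there on, so it needs at most this time plus its own number of possible moves, which is
    -- within `M`.
    have hex : ∃ h, AllHalted d ps (boolTraj ps M w₁) U₁ h := ⟨_, hhalt₁⟩
    have hle : Nat.find hex ≤ K * ps.length * U₁.length :=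
      (Nat.find_min' hex hhalt₁).trans (by omega)
    have hfind := Nat.find_spec hex
    have hmin : ∀ j, AllHalted d ps (boolTraj ps M w₁) U₁ j → Nat.find hex ≤ j :=
      fun j hj => Nat.find_min' hex hj
    obtain ⟨e, T', he, hcount, hcount', hpos, hmov⟩ :=
      exists_compression (d := d) (Nat.find hex) hfair
    have hhalt : AllHalted d ps T' U₂ M := (allHalted_of_moves hd hmov).mono (by omega)
    obtain ⟨w₂, hw₂, hw₂'⟩ := exists_boolTraj (ps := ps) (M := M) w₁ T' U₂
    have heq : ∀ τ ∈ U₁, boolTraj ps M w₂ τ = boolTraj ps M w₁ τ :=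
      fun τ hτ => boolTraj_congr hw₂ (hU τ hτ)
    refine (hH e T₂ (boolTraj ps M w₂) he ?_).2 ((hw₁ w₂ hw₂).2 fun j hj => ?_)
    · rintro τ (hτ | hτ) π hπ n
      · rw [hT₂ τ hτ, heq τ hτ]
        rcases le_total n (Nat.find hex) with hn | hn
        · rw [hcount n hn]
        · rw [hfind.mono hn τ hτ π hπ, hfind.mono (hcount' n hn) τ hτ π hπ]
      · rw [hpos τ hτ π hπ, position_boolTraj hw₂' hhalt hτ hπ]
    -- Inner moves are demanded only where the outer block has halted, and by minimality such `j`
    -- lie in the compressed range.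
    · refine moves_boolTraj hw₂' hhalt (hmov j (hmin j fun τ hτ => ?_))
      rw [← heq τ hτ]
      exact hj τ hτ

end Encoding

/-! ### Depths of paths -/

namespace Kripke

variable {S AP : Type*} {𝒦 : Kripke S AP}

/-- `d` is the depth of `p`: the states from index `d` on are the terminal ones. -/
def IsDepth (𝒦 : Kripke S AP) (p : ℕ → S) (d : ℕ) : Prop := ∀ i, 𝒦.Terminal (p i) ↔ d ≤ i

theorem IsPath.eq_of_terminal {p : ℕ → S} (hp : 𝒦.IsPath p) {i : ℕ} (h : 𝒦.Terminal (p i))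
    {j : ℕ} (hij : i ≤ j) : p j = p i := by
  induction j, hij using Nat.le_induction with
  | base => rfl
  | succ j _ ih =>
    have hrel := hp.2 j
    rw [ih] at hrel
    exact h _ hrel

theorem IsPath.eq_min {p : ℕ → S} (hp : 𝒦.IsPath p) {d : ℕ} (hd : 𝒦.IsDepth p d) (i : ℕ) :
    p i = p (min d i) := by
  rcases le_total d i with h | h
  · rw [min_eq_left h, hp.eq_of_terminal ((hd d).2 le_rfl) h]
  · rw [min_eq_right h]

theorem IsMaxDepth.exists_isDepth {K : ℕ} (hK : 𝒦.IsMaxDepth K) {p : ℕ → S}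
    (hp : 𝒦.IsPath p) : ∃ d ≤ K, 𝒦.IsDepth p d := by
  classical
  have hex : ∃ d, d ≤ K ∧ 𝒦.Terminal (p d) := by
    by_contra! h
    -- Without a terminal state among the indices up to `K`, the path would exhibit `K + 1`
    -- transitions before halting.
    have : K + 1 ≤ K := hK.2 ⟨p, hp, fun i hi => h i (by omega)⟩
    omega
  obtain ⟨h₁, h₂⟩ := Nat.find_spec hex
  refine ⟨Nat.find hex, h₁, fun i => ⟨fun h => ?_, fun h => ?_⟩⟩
  · rcases le_total i K with hi | hi
    · exact Nat.find_min' hex ⟨hi, h⟩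
    · exact h₁.trans hi
  · rwa [hp.eq_of_terminal h₂ h]

end Kripke

namespace Encoding

open PropForm

/-! ### Decoding states and unrollings -/

section System

variable {S AP V J B : Type*} [FinEnum B] {𝒦 : Kripke S AP} {code : S ↪ (B → Bool)}
  {v : BVar V J B → Bool}

theorem eval_stateIs {π : V} {i : ℕ} {s : S} :
    (stateIs code π i s).eval v = true ↔ ∀ b, v (.x π i b) = code s b := by
  simp only [stateIs, eval_conj, FinEnum.mem_toList, forall_const]
  refine forall_congr' fun b => ?_
  cases code s b <;> simp

variable [FinEnum S]

theorem eval_stateIn {P : S → Prop} [DecidablePred P] {π : V} {i : ℕ} :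
    (stateIn code P π i).eval v = true ↔ ∃ s, P s ∧ ∀ b, v (.x π i b) = code s b := by
  simp [stateIn, eval_stateIs]

theorem eval_stateIn_of_code {P : S → Prop} [DecidablePred P] {π : V} {i : ℕ} {s : S}
    (hs : ∀ b, v (.x π i b) = code s b) : (stateIn code P π i).eval v = true ↔ P s := by
  rw [eval_stateIn]
  refine ⟨fun ⟨s', hP, hs'⟩ => ?_, fun hP => ⟨s, hP, hs⟩⟩
  have : s' = s := code.injective (funext fun b => (hs' b).symm.trans (hs b))
  exact this ▸ hP

/-- Totality extends the decoded finite run to an infinite path. Injectivity of the code identifies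
the source state of each transition with the last state decoded before it. -/
theorem eval_unrollF [DecidableRel 𝒦.rel] {k : ℕ} {π : V} :
    (unrollF 𝒦 code k π).eval v = true ↔
      ∃ p, 𝒦.IsPath p ∧ ∀ i ≤ k, ∀ b, v (.x π i b) = code (p i) b := by
  simp only [unrollF, initF, transF, eval_and, Bool.and_eq_true, eval_conj, eval_disj,
    eval_stateIs, eval_stateIn, FinEnum.mem_toList, true_and, List.mem_range]
  constructor
  · rintro ⟨h₀, hstep⟩
    have key : ∀ n ≤ k, ∃ p : ℕ → S, 𝒦.IsPath p ∧ ∀ i ≤ n, ∀ b, v (.x π i b) = code (p i) b := by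
      intro n
      choose next hnext using 𝒦.total
      induction n with
      | zero =>
        intro _
        refine ⟨fun i => next^[i] 𝒦.init, ⟨rfl, fun i => ?_⟩, fun i hi b => ?_⟩
        · simp only [Function.iterate_succ_apply']
          exact hnext _
        · obtain rfl : i = 0 := by omega
          exact h₀ b
      | succ n ih =>
        intro hn
        obtain ⟨p, hp, hc⟩ := ih (by omega)
        obtain ⟨s, hs, s', hrel, hs'⟩ := hstep n (by omega)
        have hsp : s = p n :=
          code.injective (funext fun b => (hs b).symm.trans (hc n le_rfl b))
        subst hsp
        -- The path is kept up to `n`, continued by the decoded successor `s'`, and then by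
        -- arbitrary successors.
        refine ⟨fun i => if i ≤ n then p i else next^[i - (n + 1)] s', ⟨by simp [hp.1],
          fun i => ?_⟩, fun i hi b => ?_⟩
        · rcases lt_trichotomy i n with h | rfl | h
          · simpa [h.le, Nat.succ_le_of_lt h] using hp.2 i
          · simpa using hrel
          · have h₁ : ¬ i ≤ n := by omega
            have h₂ : ¬ i + 1 ≤ n := by omega
            have h₃ : i + 1 - (n + 1) = (i - (n + 1)) + 1 := by omega
            simp only [h₁, h₂, if_false, h₃, Function.iterate_succ_apply']
            exact hnext _
        · rcases Nat.lt_or_ge n i with h | h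
          · obtain rfl : i = n + 1 := by omega
            simpa using hs' b
          · simpa [h] using hc i h b
    exact key k le_rfl
  · rintro ⟨p, hp, hc⟩
    refine ⟨fun b => hp.1 ▸ hc 0 (Nat.zero_le _) b, fun i hi => ⟨p i, hc i hi.le, p (i + 1),
      hp.2 i, hc (i + 1) hi⟩⟩

end System

/-! ### Meaning of the position constraints -/

section Positions

variable {V J B : Type*} {ps : List V} {ts : List J} {K M : ℕ}
  {halt : V → ℕ → PropForm (BVar V J B)} {v : BVar V J B → Bool}

theorem eval_setpos {π : V} {τ : J} {i j : ℕ} (hi : i ≤ K) :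
    (setpos K π τ i j).eval v = true ↔
      (∀ n ≤ K, (v (.pos π τ n j) = true ↔ n = i)) ∧ v (.off π τ j) = false := by
  simp only [setpos, posF, offF, eval_and, eval_var, eval_neg, eval_conj, Bool.and_eq_true,
    Bool.not_eq_true', List.mem_filter, List.mem_range, Nat.lt_succ_iff, decide_eq_true_eq,
    and_imp]
  constructor
  · rintro ⟨h₁, h₂, h₃⟩
    refine ⟨fun n hn => ⟨fun h => ?_, fun h => h ▸ h₁⟩, h₃⟩
    by_contra hne
    simp [h₂ n hn hne] at h
  · rintro ⟨h₁, h₂⟩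
    refine ⟨(h₁ i hi).2 rfl, fun n hn hne => ?_, h₂⟩
    rw [← Bool.not_eq_true, h₁ n hn]
    exact hne

variable (ps ts K M v) in
/-- The position variables describe the positions, capped at `K`, along the trajectories that the
valuation encodes. -/
def PosCorrect : Prop :=
  ∀ π ∈ ps, ∀ τ ∈ ts, ∀ j ≤ M + 1,
    (∀ i ≤ K, (v (.pos π τ i j) = true ↔
      i = position (fun _ => K) (boolTraj ps M v τ) j π)) ∧ v (.off π τ j) = false

theorem mem_boolTraj {τ : J} {π : V} {j : ℕ} (hπ : π ∈ ps) (hj : j ≤ M) :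
    π ∈ boolTraj ps M v τ j ↔ v (.t τ π j) = true :=
  ⟨fun h => h.2 hj, fun h => ⟨hπ, fun _ => h⟩⟩

/-- Every path is halting at index `K`, so a move at the end of the unrolling stays at `K` and never
switches `off` on. The clauses then force, step by step, the number of moves capped at `K`. -/
theorem eval_phiPos (hhalt : ∀ π ∈ ps, (halt π K).eval v = true) :
    (phiPos ps ts K M halt).eval v = true ↔ PosCorrect ps ts K M v := by
  simp only [phiPos, initPos, step, stutters, ends, eval_and, Bool.and_eq_true, eval_conj,
    eval_imp, List.mem_range, Nat.lt_succ_iff, posF, tF, eval_var, eval_neg, Bool.not_eq_true']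
  constructor
  · rintro ⟨h₀, hstep⟩ π hπ τ hτ j
    induction j with
    | zero =>
      intro _
      rw [position_zero]
      exact (eval_setpos (Nat.zero_le _)).1 (h₀ π hπ τ hτ)
    | succ j ih =>
      intro hj
      obtain ⟨ih, -⟩ := ih (by omega)
      obtain ⟨h₁, h₂, h₃⟩ := hstep j (by omega) π hπ τ hτ
      have hle := position_le (fun _ => K) (boolTraj ps M v τ) j π
      have hp := (ih _ hle).2 rfl
      refine (eval_setpos (K := K) (position_le (fun _ => K) _ _ _)).1 ?_
      have hmem := mem_boolTraj (v := v) (τ := τ) hπ (show j ≤ M by omega)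
      by_cases ht : v (.t τ π j) = true
      · rw [position_succ_of_mem _ (hmem.2 ht)]
        rcases hle.lt_or_eq with hlt | heq
        · rw [min_eq_right (by omega)]
          exact h₁ _ hlt ⟨hp, ht⟩
        · rw [heq, min_eq_left (by omega)]
          exact (h₃ ⟨heq ▸ hp, ht⟩).2 (hhalt π hπ)
      · rw [position_succ_of_notMem _ (hmem.not.2 ht)]
        exact h₂ _ hle ⟨hp, by simpa using ht⟩
  · intro h
    have hset : ∀ π ∈ ps, ∀ τ ∈ ts, ∀ j ≤ M + 1, ∀ i,
        i = position (fun _ => K) (boolTraj ps M v τ) j π →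
          (setpos K π τ i j).eval v = true := by
      rintro π hπ τ hτ j hj i rfl
      exact (eval_setpos (position_le _ _ _ _)).2 (h π hπ τ hτ j hj)
    refine ⟨fun π hπ τ hτ => hset π hπ τ hτ 0 (Nat.zero_le _) 0 (by simp),
      fun j hj π hπ τ hτ => ?_⟩
    have hpos := (h π hπ τ hτ j (by omega)).1
    have hmem := mem_boolTraj (v := v) (τ := τ) hπ hj
    refine ⟨fun i hi ⟨hi', ht⟩ => ?_, fun i hi ⟨hi', ht⟩ => ?_, fun ⟨hi', ht⟩ => ⟨fun hf => ?_,
      fun _ => ?_⟩⟩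
    · refine hset π hπ τ hτ _ (by omega) _ ?_
      rw [position_succ_of_mem _ (hmem.2 ht), ← (hpos i hi.le).1 hi']
      omega
    · refine hset π hπ τ hτ _ (by omega) _ ?_
      rw [position_succ_of_notMem _ (hmem.not.2 (by simp [ht])), ← (hpos i hi).1 hi']
    · simp [hhalt π hπ] at hf
    · refine hset π hπ τ hτ _ (by omega) _ ?_
      rw [position_succ_of_mem _ (hmem.2 ht), ← (hpos K le_rfl).1 hi']
      omega

theorem mem_posVars {π : V} {τ : J} {i j : ℕ} (hπ : π ∈ ps) (hτ : τ ∈ ts) (hi : i ≤ K)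
    (hj : j ≤ M + 1) : BVar.pos π τ i j ∈ posVars B ps ts K M := by
  simp only [posVars, List.mem_flatMap, List.mem_map, List.mem_range]
  exact ⟨π, hπ, τ, hτ, i, by omega, j, by omega, rfl⟩

theorem mem_offVars {π : V} {τ : J} {j : ℕ} (hπ : π ∈ ps) (hτ : τ ∈ ts)
    (hj : j ≤ M + 1) : BVar.off π τ j ∈ offVars B ps ts M := by
  simp only [offVars, List.mem_flatMap, List.mem_map, List.mem_range]
  exact ⟨π, hπ, τ, hτ, j, by omega, rfl⟩

theorem x_notMem {π : V} {i : ℕ} {b : B} :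
    BVar.x π i b ∉ posVars B ps ts K M ++ offVars B ps ts M := by
  simp [posVars, offVars]

theorem t_notMem {π : V} {τ : J} {j : ℕ} :
    BVar.t τ π j ∉ posVars B ps ts K M ++ offVars B ps ts M := by
  simp [posVars, offVars]

/-- The values can be read off the trajectory variables, which are not among the variables being
changed, so the trajectories stay the same. -/
theorem exists_posCorrect (v : BVar V J B → Bool) :
    ∃ v', (∀ x ∉ posVars B ps ts K M ++ offVars B ps ts M, v' x = v x) ∧
      PosCorrect ps ts K M v' := by
  classical
  set v' : BVar V J B → Bool := fun x => if x ∈ posVars B ps ts K M ++ offVars B ps ts M then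
    (match x with
      | .pos π τ i j => decide (i = position (fun _ => K) (boolTraj ps M v τ) j π)
      | _ => false) else v x with hv'
  have hagree : ∀ x ∉ posVars B ps ts K M ++ offVars B ps ts M, v' x = v x :=
    fun x hx => if_neg hx
  have hT : ∀ τ, boolTraj ps M v' τ = boolTraj ps M v τ := by
    intro τ
    funext n
    ext π
    simp only [boolTraj, Set.mem_ofPred_eq, hagree _ t_notMem]
  refine ⟨v', hagree, fun π hπ τ hτ j hj => ⟨fun i hi => ?_, ?_⟩⟩
  · rw [hT, hv']
    simp only [List.mem_append, mem_posVars hπ hτ hi hj, true_or, if_true, decide_eq_true_eq]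
  · rw [hv']
    simp only [List.mem_append, mem_offVars hπ hτ hj, or_true, if_true]

end Positions

end Encoding

/-! ### Evaluation of the encoding for valuations that code paths -/

namespace Encoding

open PropForm

variable {S AP V J B : Type*} {𝒦 : Kripke S AP} {code : S ↪ (B → Bool)}

/-- Paths for the trace variables in `ps`, with their depths. -/
structure IsPathAssignment (𝒦 : Kripke S AP) (ps : List V) (K : ℕ) (pth : V → ℕ → S)
    (d : V → ℕ) : Prop where
  isPath : ∀ π ∈ ps, 𝒦.IsPath (pth π)
  isDepth : ∀ π ∈ ps, 𝒦.IsDepth (pth π) (d π)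
  le : ∀ π ∈ ps, d π ≤ K

/-- The valuation encodes the paths up to index `K`. -/
def CodesPaths (code : S ↪ (B → Bool)) (ps : List V) (K : ℕ) (pth : V → ℕ → S)
    (v : BVar V J B → Bool) : Prop :=
  ∀ π ∈ ps, ∀ i ≤ K, ∀ b, v (.x π i b) = code (pth π i) b

/-- The valuation of the atoms along trajectories. -/
def labelAt (𝒦 : Kripke S AP) (ps : List V) (ts : List J) (pth : V → ℕ → S) (d : V → ℕ)
    (T : J → Trajectory V) (n : ℕ) (a : AP) (π : V) (τ : J) : Prop :=
  π ∈ ps ∧ τ ∈ ts ∧ a ∈ 𝒦.label (pth π (position d (T τ) n π))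

variable {ps : List V} {ts : List J} {K M : ℕ} {pth : V → ℕ → S} {d : V → ℕ}
  {v : BVar V J B → Bool}

theorem eval_offAny (hpos : PosCorrect ps ts K M v) {j : ℕ} (hj : j ≤ M) : (offAny ps ts j).eval v = false := by
  rw [← Bool.not_eq_true]
  simp only [offAny, eval_disj, offF, eval_var]
  rintro ⟨π, hπ, τ, hτ, h⟩
  simp [(hpos π hπ τ hτ j (by omega)).2] at h

section Eval

variable (hpth : IsPathAssignment 𝒦 ps K pth d) (hcode : CodesPaths code ps K pth v)
  (hpos : PosCorrect ps ts K M v)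

include hpth

/-- The position variables cap at the common bound `K`, the semantic argument at the individual
depth. As the depth is at most `K`, the former count determines the latter. -/
theorem position_eq_min {π : V} (hπ : π ∈ ps) (t : Trajectory V) (n : ℕ) :
    position d t n π = min (d π) (position (fun _ => K) t n π) := by
  have := hpth.le π hπ
  simp only [position]
  omega

variable [FinEnum S] [FinEnum B] [DecidableRel 𝒦.rel]

include hcode

theorem eval_haltF {π : V} (hπ : π ∈ ps) {i : ℕ} (hi : i ≤ K) :
    (haltF 𝒦 code π i).eval v = true ↔ d π ≤ i := by
  rw [haltF, eval_stateIn_of_code (hcode π hπ i hi), hpth.isDepth π hπ]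

include hpos

theorem eval_haltAt {π : V} (hπ : π ∈ ps) {τ : J} (hτ : τ ∈ ts) {j : ℕ} (hj : j ≤ M) :
    (haltAt K (haltF 𝒦 code) π τ j).eval v = true ↔
      position d (boolTraj ps M v τ) j π = d π := by
  have h := (hpos π hπ τ hτ j (by omega)).1
  simp only [haltAt, eval_disj, List.mem_range, Nat.lt_succ_iff, eval_and, Bool.and_eq_true, posF,
    eval_var]
  rw [position_eq_min hpth hπ, min_eq_left_iff]
  constructor
  · rintro ⟨i, hi, hp, hh⟩
    rw [eval_haltF hpth hcode hπ hi] at hh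
    rwa [(h i hi).1 hp] at hh
  · intro hh
    have hle := position_le (fun _ => K) (boolTraj ps M v τ) j π
    exact ⟨_, hle, (h _ hle).2 rfl, (eval_haltF hpth hcode hπ hle).2 hh⟩

theorem eval_halted {U : List J} (hU : ∀ τ ∈ U, τ ∈ ts) {j : ℕ} (hj : j ≤ M) :
    (halted ps K (haltF 𝒦 code) U j).eval v = true ↔
      AllHalted d ps (boolTraj ps M v) U j := by
  simp only [halted, eval_conj, AllHalted]
  exact forall₂_congr fun τ hτ => forall₂_congr fun π hπ =>
    eval_haltAt hpth hcode hpos hπ (hU τ hτ) hj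

theorem eval_moves {U : List J} (hU : ∀ τ ∈ U, τ ∈ ts) {j : ℕ} (hj : j ≤ M) :
    (moves ps K (haltF 𝒦 code) U j).eval v = true ↔ Moves d ps (boolTraj ps M v) U j := by
  rw [moves, eval_or, Bool.or_eq_true, eval_halted hpth hcode hpos hU hj, Moves]
  simp only [eval_disj, eval_and, eval_neg, tF, eval_var, Bool.and_eq_true, Bool.not_eq_true',
    ← Bool.not_eq_true]
  refine or_congr_right (exists_congr fun τ => and_congr_right fun hτ =>
    exists_congr fun π => and_congr_right fun hπ => ?_)
  rw [mem_boolTraj hπ hj, eval_haltAt hpth hcode hpos hπ (hU τ hτ) hj]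

theorem eval_allMove {U : List J} (hU : ∀ τ ∈ U, τ ∈ ts) :
    (allMove ps K M (haltF 𝒦 code) U).eval v = true ↔
      ∀ j, Moves d ps (boolTraj ps M v) U j := by
  simp only [allMove, eval_conj, List.mem_range, Nat.lt_succ_iff]
  refine forall_congr' fun j => ?_
  rcases le_or_gt j M with hj | hj
  · simp [hj, eval_moves hpth hcode hpos hU hj]
  -- Beyond `M` the encoding says nothing and the semantic condition holds automatically.
  · simp [hj, moves_boolTraj_of_le hj]

theorem eval_allMoveAfter {U₁ U₂ : List J} (hU₁ : ∀ τ ∈ U₁, τ ∈ ts) (hU₂ : ∀ τ ∈ U₂, τ ∈ ts) :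
    (allMoveAfter ps K M (haltF 𝒦 code) U₁ U₂).eval v = true ↔
      ∀ j, AllHalted d ps (boolTraj ps M v) U₁ j → Moves d ps (boolTraj ps M v) U₂ j := by
  simp only [allMoveAfter, eval_conj, List.mem_range, Nat.lt_succ_iff, eval_imp]
  refine forall_congr' fun j => ?_
  rcases le_or_gt j M with hj | hj
  · simp [hj, eval_moves hpth hcode hpos hU₂ hj, eval_halted hpth hcode hpos hU₁ hj]
  · simp [hj, moves_boolTraj_of_le hj]

variable [∀ a, DecidablePred fun s => a ∈ 𝒦.label s]

theorem eval_lit (mode : Mode) {j : ℕ} (hj : j ≤ M) (b : Bool) (a : AP) {π : V} (hπ : π ∈ ps)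
    {τ : J} (hτ : τ ∈ ts) :
    (ltlF ps ts K M (haltF 𝒦 code) (propF 𝒦 code) mode (.lit b a π τ) j).eval v = true ↔
      (labelAt 𝒦 ps ts pth d (boolTraj ps M v) j a π τ ↔ b = true) := by
  have h := (hpos π hπ τ hτ j (by omega)).1
  have hle := position_le (fun _ => K) (boolTraj ps M v τ) j π
  have hlab : labelAt 𝒦 ps ts pth d (boolTraj ps M v) j a π τ ↔
      a ∈ 𝒦.label (pth π (position (fun _ => K) (boolTraj ps M v τ) j π)) := by
    -- Both caps yield the same state, because the path is constant from its depth on.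
    rw [(hpth.isPath π hπ).eq_min (hpth.isDepth π hπ) (position (fun _ => K) _ j π),
      ← position_eq_min hpth hπ]
    exact ⟨fun h => h.2.2, fun h => ⟨hπ, hτ, h⟩⟩
  have hprop := fun i hi => eval_stateIn_of_code (P := fun s => a ∈ 𝒦.label s)
    (hcode π hπ i hi)
  rw [hlab]
  cases b <;> simp only [ltlF, eval_disj, List.mem_range, Nat.lt_succ_iff, eval_and, posF,
    eval_var, Bool.and_eq_true, propF, eval_neg, Bool.not_eq_true', ← Bool.not_eq_true]
  · simp only [Bool.false_eq_true, iff_false]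
    constructor
    · rintro ⟨i, hi, hp, ha⟩
      rwa [hprop i hi, (h i hi).1 hp] at ha
    · intro ha
      exact ⟨_, hle, (h _ hle).2 rfl, by rwa [hprop _ hle]⟩
  · simp only [iff_true]
    constructor
    · rintro ⟨i, hi, hp, ha⟩
      rwa [hprop i hi, (h i hi).1 hp] at ha
    · intro ha
      exact ⟨_, hle, (h _ hle).2 rfl, by rwa [hprop _ hle]⟩

/-- The encoding of a temporal formula is exact if everything halts within the bound. -/
theorem eval_ltlF_iff_holds (hhalt : AllHalted d ps (boolTraj ps M v) ts M) (mode : Mode)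
    {ψ : LTL AP V J} (hψ : ψ.VarsIn ps ts) :
    (ltlF ps ts K M (haltF 𝒦 code) (propF 𝒦 code) mode (ψ.toNNF true) 0).eval v = true ↔
      ψ.Holds (labelAt 𝒦 ps ts pth d (boolTraj ps M v)) 0 := by
  rw [eval_ltlF (fun j hj => eval_offAny hpos hj)
    ((eval_halted hpth hcode hpos (fun _ h => h) le_rfl).2 hhalt) ?_
    (fun j hj b a π hπ τ hτ => eval_lit hpth hcode hpos .hpes hj b a hπ hτ) mode ψ hψ true 0
    (Nat.zero_le _)]
  · simp
  · intro n hn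
    funext a π τ
    -- The membership conjuncts in `labelAt` restrict this equality of valuations to quantified
    -- variables, where halting is known.
    refine propext (and_congr_right fun hπ => and_congr_right fun hτ => ?_)
    rw [hhalt τ hτ π hπ, hhalt.mono hn τ hτ π hπ]

end Eval

/-! ## The trajectory quantifiers -/

/-- The first quantifier that differs from `q` uses up the only alternation, so all later ones agree
with it. -/
theorem dropWhile_of_alternations {q : Quant} {l : List (Quant × J)}
    (h : alternations (q :: l.map Prod.fst) ≤ 1) :
    l = ((l.takeWhile (fun p => p.1 = q)).map Prod.snd).map (fun τ => (q, τ)) ++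
      ((l.dropWhile (fun p => p.1 = q)).map Prod.snd).map (fun τ => (q.dual, τ)) := by
  have hzero : ∀ (q : Quant) (l : List (Quant × J)), alternations (q :: l.map Prod.fst) = 0 →
      l = (l.map Prod.snd).map (fun τ => (q, τ)) := by
    intro q l
    induction l generalizing q with
    | nil => simp
    | cons p l ih =>
      intro h
      simp only [List.map_cons, alternations, Nat.add_eq_zero_iff, ite_eq_left_iff, one_ne_zero,
        imp_false, not_not] at h
      obtain ⟨rfl, h⟩ := h
      rw [List.map_cons, List.map_cons, ← ih _ h]
  induction l with
  | nil => simp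
  | cons p l ih =>
    by_cases hp : p.1 = q
    · simp only [List.map_cons, alternations, hp, if_true, zero_add] at h
      simp only [hp, List.takeWhile_cons, List.dropWhile_cons, decide_true, if_true, List.map_cons,
        List.cons_append]
      rw [← ih h]
      simp [← hp]
    · have hne : ¬ q = p.1 := fun h => hp h.symm
      simp only [List.map_cons, alternations, hne, if_false] at h
      have := hzero p.1 l (by omega)
      simp only [hp, List.takeWhile_cons, List.dropWhile_cons, decide_false, List.map_cons,
        List.map_nil, List.nil_append, Bool.false_eq_true, if_false]
      rw [← Quant.ne_iff_eq_dual.1 hp, ← this]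

/-- Five cases of the encoding become two. The move condition on an empty inner block is trivially
true, so a single block is an alternation with an empty second part, and the empty prefix is an
existential one with both parts empty. -/
theorem exists_blocks {halt : V → ℕ → PropForm (BVar V J B)} {tq : List (Quant × J)}
    (h : alternations (tq.map Prod.fst) ≤ 1) :
    ∃ (q : Quant) (U₁ U₂ : List J), tq = U₁.map (fun τ => (q, τ)) ++ U₂.map (fun τ => (q.dual, τ)) ∧
      ∀ (f : PropForm (BVar V J B)) v, (enc ps K M halt tq f).eval v = true ↔
        match q with
        | .ex => (allMove ps K M halt U₁).eval v = true ∧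
            ((allMoveAfter ps K M halt U₁ U₂).eval v = true → f.eval v = true)
        | .all => (allMove ps K M halt U₁).eval v = true →
            ((allMoveAfter ps K M halt U₁ U₂).eval v = true ∧ f.eval v = true) := by
  have hnil : ∀ U v, (allMoveAfter ps K M halt U []).eval v = true := by
    simp [allMoveAfter, moves, halted]
  cases tq with
  | nil =>
    refine ⟨.ex, [], [], rfl, fun f v => ?_⟩
    simp [hnil, enc, allMove, moves, halted]
  | cons p l =>
    obtain ⟨q, τ⟩ := p
    refine ⟨q, τ :: (l.takeWhile (fun p => p.1 = q)).map Prod.snd,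
      (l.dropWhile (fun p => p.1 = q)).map Prod.snd, ?_, fun f v => ?_⟩
    · rw [List.map_cons, List.cons_append, ← dropWhile_of_alternations h]
    · simp only [enc.eq_def]
      generalize τ :: (l.takeWhile (fun p => p.1 = q)).map Prod.snd = U₁
      generalize (l.dropWhile (fun p => p.1 = q)).map Prod.snd = U₂
      cases q <;> cases U₂ <;> simp [hnil]

end Encoding

/-! ### Two alternating blocks of quantifiers -/

section Blocks

variable {X Y : Type*} [DecidableEq X] {C : Y → Prop}

theorem quantUpd_ex_all_blocks (U₁ U₂ : List X) (F : (X → Y) → Prop) (g : X → Y) :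
    quantUpd C (U₁.map (fun x => (.ex, x)) ++ U₂.map (fun x => (.all, x))) F g ↔
      ∃ g₁ : X → Y, (∀ x ∉ U₁, g₁ x = g x) ∧ (∀ x ∈ U₁, C (g₁ x)) ∧
        ∀ g₂ : X → Y, (∀ x ∉ U₂, g₂ x = g₁ x) → (∀ x ∈ U₂, C (g₂ x)) → F g₂ := by
  rw [quantUpd_append, quantUpd_ex_block]
  simp only [quantUpd_all_block]

theorem quantUpd_all_ex_blocks (U₁ U₂ : List X) (F : (X → Y) → Prop) (g : X → Y) :
    quantUpd C (U₁.map (fun x => (.all, x)) ++ U₂.map (fun x => (.ex, x))) F g ↔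
      ¬ quantUpd C (U₁.map (fun x => (.ex, x)) ++ U₂.map (fun x => (.all, x)))
        (fun g => ¬ F g) g := by
  rw [← not_iff_not, not_not, ← quantUpd_dual, List.map_append, List.map_map, List.map_map]
  rfl

/-- Quantification over partial maps that are defined on the quantified variables. -/
theorem quantUpd_some {Y : Type*} [Nonempty Y] {D : Set Y} {U₁ U₂ : List X}
    (hU : ∀ x ∈ U₁, x ∉ U₂) {F : (X → Option Y) → Prop} {H : (X → Y) → Prop}
    (hFH : ∀ G T, (∀ x, x ∈ U₁ ∨ x ∈ U₂ → G x = some (T x)) → (F G ↔ H T)) (G : X → Option Y) :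
    quantUpd (fun o => ∃ t ∈ D, o = some t)
        (U₁.map (fun x => (.ex, x)) ++ U₂.map (fun x => (.all, x))) F G ↔
      ∃ T₁ : X → Y, (∀ x ∈ U₁, T₁ x ∈ D) ∧
        ∀ T₂ : X → Y, (∀ x ∈ U₁, T₂ x = T₁ x) → (∀ x ∈ U₂, T₂ x ∈ D) → H T₂ := by
  rw [quantUpd_ex_all_blocks]
  constructor
  · rintro ⟨G₁, -, hG₁, h⟩
    refine ⟨fun x => (G₁ x).getD (Classical.arbitrary Y), fun x hx => ?_, fun T₂ h₁ h₂ => ?_⟩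
    · obtain ⟨t, ht, heq⟩ := hG₁ x hx
      simpa [heq] using ht
    -- The partial map follows `T₂` on the inner block and the chosen `G₁` elsewhere; disjointness
    -- of the blocks keeps the outer values intact.
    · refine (hFH (fun x => if x ∈ U₂ then some (T₂ x) else G₁ x) T₂ ?_).1
        (h _ (fun x hx => if_neg hx) fun x hx => ⟨T₂ x, h₂ x hx, if_pos hx⟩)
      rintro x (hx | hx)
      · obtain ⟨t, -, heq⟩ := hG₁ x hx
        simp [hU x hx, h₁ x hx, heq]
      · simp [hx]
  · rintro ⟨T₁, hT₁, h⟩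
    refine ⟨fun x => if x ∈ U₁ then some (T₁ x) else G x, fun x hx => if_neg hx,
      fun x hx => ⟨T₁ x, hT₁ x hx, if_pos hx⟩, fun G₂ h₁ h₂ => ?_⟩
    have hsome : ∀ x, x ∈ U₁ ∨ x ∈ U₂ → G₂ x = some ((G₂ x).getD (Classical.arbitrary Y)) := by
      rintro x (hx | hx)
      · simp [h₁ x (hU x hx), hx]
      · obtain ⟨t, -, heq⟩ := h₂ x hx
        simp [heq]
    refine (hFH G₂ _ hsome).2 (h _ (fun x hx => ?_) fun x hx => ?_)
    · simp [h₁ x (hU x hx), hx]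
    · obtain ⟨t, ht, heq⟩ := h₂ x hx
      simpa [heq] using ht

end Blocks

/-! ## Satisfaction in terms of positions -/

namespace Assignment

variable {AP V J : Type*}

theorem traj_iterate_succ {A : Assignment AP V J} {τ : J} {t : Trajectory V}
    (ht : A.traj τ = some t) (n : ℕ) :
    (succ^[n] A).traj τ = some fun i => t (i + n) := by
  induction n with
  | zero => simpa using ht
  | succ n ih =>
    rw [Function.iterate_succ_apply']
    simp only [succ, ih, Option.map_some]
    congr 1
    funext i
    congr 1
    omega

open Classical in
theorem trace_iterate_succ {A : Assignment AP V J} {τ : J} {t : Trajectory V}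
    (ht : A.traj τ = some t) {π : V} {σ : Trace AP} (hσ : A.trace π τ = some (σ, 0)) (n : ℕ) :
    (succ^[n] A).trace π τ = some (σ, Nat.count (fun i => π ∈ t i) n) := by
  induction n with
  | zero => simpa using hσ
  | succ n ih =>
    rw [Function.iterate_succ_apply']
    simp only [succ, traj_iterate_succ ht n, ih, Option.some.injEq, exists_eq_left', zero_add,
      Nat.count_succ]
    by_cases h : π ∈ t n <;> simp [h]

end Assignment

/-- Choosing a trajectory leaves the trace part of the assignment unchanged, so all quantifiers of
the prefix range over the same set of fair trajectories. -/
theorem Formula.sat_iff_quantUpd {AP V J : Type*} [DecidableEq V] [DecidableEq J]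
    (𝒯 : Set (Trace AP)) (φ : Formula AP V J) (hφ : φ.IsTrajPrefix) (A : Assignment AP V J) :
    φ.Sat 𝒯 A ↔ quantUpd (fun o => ∃ t ∈ fairTrajectories A.dom, o = some t) φ.trajQs
      (fun G => φ.inner.Sat ⟨A.trace, G⟩) A.traj := by
  induction φ generalizing A with
  | path q π φ ih => exact hφ.elim
  | body ψ => rfl
  | traj q τ φ ih =>
    have ih' := fun t => ih hφ (A.setTraj τ t)
    cases q
    · simp only [Sat, ih', trajQs, quantUpd]
      exact ⟨by rintro h _ ⟨t, ht, rfl⟩; exact h t ht, fun h t ht => h _ ⟨t, ht, rfl⟩⟩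
    · simp only [Sat, ih', trajQs, quantUpd]
      exact ⟨fun ⟨t, ht, h⟩ => ⟨_, ⟨t, ht, rfl⟩, h⟩,
        by rintro ⟨_, ⟨t, ht, rfl⟩, h⟩; exact ⟨t, ht, h⟩⟩

namespace Encoding

open PropForm

variable {S AP V J B : Type*} {𝒦 : Kripke S AP} {code : S ↪ (B → Bool)}
  {ps : List V} {ts : List J} {K M : ℕ} {pth : V → ℕ → S} {d : V → ℕ}

open Classical in
/-- The assignment maps the variables in `ps` to the initial points of the traces of the paths. -/
def AssignsPaths (𝒦 : Kripke S AP) (ps : List V) (pth : V → ℕ → S) (A : Assignment AP V J) :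
    Prop :=
  ∀ π τ, A.trace π τ = if π ∈ ps then some (fun i => 𝒦.label (pth π i), 0) else none

theorem AssignsPaths.dom_eq [Nonempty J] {A : Assignment AP V J}
    (hA : AssignsPaths 𝒦 ps pth A) : A.dom = {π | π ∈ ps} := by
  ext π
  simp [Assignment.dom, hA π]

/-- The semantic pointer is the uncapped number of moves. Capping it at the depth does not change
the state reached. -/
theorem sat_iff_holds (hpth : IsPathAssignment 𝒦 ps K pth d) {A : Assignment AP V J}
    (hA : AssignsPaths 𝒦 ps pth A) {T : J → Trajectory V}
    (hT : ∀ τ ∈ ts, A.traj τ = some (T τ)) {ψ : LTL AP V J} (hψ : ψ.VarsIn ps ts) :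
    ψ.Sat A ↔ ψ.Holds (labelAt 𝒦 ps ts pth d T) 0 := by
  refine LTL.sat_iterate_iff_holds (A := A) (fun n a π hπ τ hτ => ?_) ψ hψ 0
  have htr := Assignment.trace_iterate_succ (hT τ hτ) ((hA π τ).trans (if_pos hπ)) n
  simp only [LTL.Sat, htr, Option.some.injEq, Prod.mk.injEq, labelAt, hπ, hτ, true_and, position]
  rw [← (hpth.isPath π hπ).eq_min (hpth.isDepth π hπ)]
  constructor
  · rintro ⟨_, _, ⟨rfl, rfl⟩, h⟩
    exact h
  · exact fun h => ⟨_, _, ⟨rfl, rfl⟩, h⟩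

/-- The outer block halts within its own number of possible moves; from then on the inner block has
to move, and its moves add to that time. -/
theorem allHalted_of_moves_blocks (hd : ∀ π ∈ ps, d π ≤ K) {U₁ U₂ : List J}
    {T : J → Trajectory V} (hts : ∀ τ ∈ ts, τ ∈ U₁ ∨ τ ∈ U₂)
    (hM : K * ps.length * U₁.length + K * ps.length * U₂.length ≤ M)
    (h₁ : ∀ j, Moves d ps T U₁ j) (h₂ : ∀ j, AllHalted d ps T U₁ j → Moves d ps T U₂ j) :
    AllHalted d ps T ts M := by
  have hh₁ := allHalted_of_moves hd (h := 0) fun j _ => h₁ j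
  have hh₂ := allHalted_of_moves hd fun j hj => h₂ j (hh₁.mono hj)
  intro τ hτ
  rcases hts τ hτ with h | h
  · exact (hh₁.mono (by omega)) τ h
  · exact (hh₂.mono (by omega)) τ h

/-- The quantifiers of a prefix `E⁺A⁺` over fair trajectories and over their encodings. -/
theorem quantUpd_traj_iff [DecidableEq V] [DecidableEq J] [DecidableEq B]
    (hd : ∀ π ∈ ps, d π ≤ K) {U₁ U₂ : List J} (hU : ∀ τ ∈ U₁, τ ∉ U₂)
    (hM : K * ps.length * U₁.length + K * ps.length * U₂.length ≤ M)
    {H : (J → Trajectory V) → Prop}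
    (hH : ∀ (e : ℕ → Prop) [DecidablePred e] (T T' : J → Trajectory V), {n | e n}.Infinite →
      (∀ τ, τ ∈ U₁ ∨ τ ∈ U₂ → ∀ π ∈ ps, ∀ n,
        position d (T τ) n π = position d (T' τ) (Nat.count e n) π) → (H T ↔ H T'))
    {F : (J → Option (Trajectory V)) → Prop}
    (hF : ∀ G T, (∀ τ, τ ∈ U₁ ∨ τ ∈ U₂ → G τ = some (T τ)) → (F G ↔ H T))
    {F' : (BVar V J B → Bool) → Prop} {w : BVar V J B → Bool}
    (hF' : ∀ w', (∀ π i b, w' (.x π i b) = w (.x π i b)) →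
      (F' w' ↔ (∀ j, Moves d ps (boolTraj ps M w') U₁ j) ∧
        ((∀ j, AllHalted d ps (boolTraj ps M w') U₁ j → Moves d ps (boolTraj ps M w') U₂ j) →
          H (boolTraj ps M w'))))
    (G : J → Option (Trajectory V)) :
    quantUpd (fun o => ∃ t ∈ fairTrajectories {π | π ∈ ps}, o = some t)
        (U₁.map (fun x => (.ex, x)) ++ U₂.map (fun x => (.all, x))) F G ↔
      quantUpd (fun _ => True) ((U₁.flatMap (tVars B ps M)).map (fun x => (.ex, x)) ++
        (U₂.flatMap (tVars B ps M)).map (fun x => (.all, x))) F' w := by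
  have hx : ∀ (U : List J) π i b, BVar.x π i b ∉ U.flatMap (tVars B ps M) := by
    intro U π i b
    simp [mem_tVars]
  rw [quantUpd_some hU hF, exists_forall_fair_iff hd hU hM (fun e T T' => by classical exact hH e T T')
    w, quantUpd_ex_all_blocks]
  simp only [implies_true, true_and, forall_const]
  refine exists_congr fun w₁ => and_congr_right fun h₁ => forall₂_congr fun w₂ h₂ => ?_
  refine (hF' w₂ fun π i b => ?_).symm
  rw [h₂ _ (hx U₂ π i b), h₁ _ (hx U₁ π i b)]

theorem holds_labelAt_congr {ψ : LTL AP V J} {e : ℕ → Prop} [DecidablePred e]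
    {T T' : J → Trajectory V} (he : {n | e n}.Infinite)
    (h : ∀ τ ∈ ts, ∀ π ∈ ps, ∀ n,
      position d (T τ) n π = position d (T' τ) (Nat.count e n) π) :
    ψ.Holds (labelAt 𝒦 ps ts pth d T) 0 ↔ ψ.Holds (labelAt 𝒦 ps ts pth d T') 0 := by
  have := LTL.holds_count he (lab := labelAt 𝒦 ps ts pth d T) (lab' := labelAt 𝒦 ps ts pth d T')
    (fun n => ?_) ψ 0
  · rwa [Nat.count_zero] at this
  · funext a π τ
    exact propext (and_congr_right fun hπ => and_congr_right fun hτ => by rw [h τ hτ π hπ])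

end Encoding

/-! ### Correctness for fixed paths, and the quantifier prefix of the QBF -/

namespace Encoding

open PropForm

variable {S AP V J B : Type*} {𝒦 : Kripke S AP} {code : S ↪ (B → Bool)} {ps : List V}
  {ts : List J} {K M : ℕ} {pth : V → ℕ → S} {d : V → ℕ}

theorem flatMap_blocks {X : Type*} (vars : J → List X) (q q' : Quant) (U₁ U₂ : List J) :
    ((U₁.map (fun τ => (q, τ)) ++ U₂.map (fun τ => (q', τ))).flatMap fun p =>
      (vars p.2).map fun x => (p.1, x)) =
    (U₁.flatMap vars).map (fun x => (q, x)) ++ (U₂.flatMap vars).map (fun x => (q', x)) := by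
  simp [List.flatMap_append, List.flatMap_map, List.map_flatMap]

variable (B ps K M) in
/-- The quantifiers over the trajectory, position, and offset variables. -/
def innerPrefix (tq : List (Quant × J)) (ts : List J) : List (Quant × BVar V J B) :=
  (tq.flatMap fun p => (tVars B ps M p.2).map fun x => (p.1, x)) ++
    (posVars B ps ts K M ++ offVars B ps ts M).map fun x => (.ex, x)

variable [FinEnum B]

theorem mem_xVars {π : V} {x : BVar V J B} :
    x ∈ xVars B V J K π ↔ ∃ i ≤ K, ∃ b, x = .x π i b := by
  simp only [xVars, List.mem_flatMap, List.mem_range, Nat.lt_succ_iff, List.mem_map,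
    FinEnum.mem_toList, true_and, eq_comm]

variable (B V J K) in
/-- The quantifiers over the states of the paths. -/
def outerPrefix (pq : List (Quant × V)) : List (Quant × BVar V J B) :=
  pq.flatMap fun p => (xVars B V J K p.2).map fun x => (p.1, x)

theorem ne_x_of_mem_prefix {pq : List (Quant × V)} {tq : List (Quant × J)} {π : V}
    (hπ : π ∉ pq.map Prod.snd) {p : Quant × BVar V J B}
    (hp : p ∈ outerPrefix V J B K pq ++ innerPrefix B ps K M tq ts) (i : ℕ) (b : B) :
    p.2 ≠ .x π i b := by
  rintro heq
  simp only [outerPrefix, innerPrefix, List.mem_append, List.mem_flatMap, List.mem_map] at hp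
  rcases hp with ⟨p', hp', x, hx, rfl⟩ | ⟨p', hp', x, hx, rfl⟩ | ⟨x, hx, rfl⟩
  · obtain ⟨i', -, b', rfl⟩ := mem_xVars.1 hx
    cases heq
    exact hπ (List.mem_map_of_mem hp')
  · obtain ⟨π', -, j, -, rfl⟩ := mem_tVars.1 hx
    cases heq
  · cases heq
    exact x_notMem (List.mem_append.2 hx)

variable [FinEnum S] [DecidableRel 𝒦.rel]

variable (𝒦 code K) in
/-- Relativize a formula to the unrollings of the structure. -/
def relativize (pq : List (Quant × V)) (f : PropForm (BVar V J B)) : PropForm (BVar V J B) :=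
  pq.foldr (fun p f =>
    match p.1 with
    | .all => imp (unrollF 𝒦 code K p.2) f
    | .ex => .and (unrollF 𝒦 code K p.2) f) f

variable [DecidableEq V] [DecidableEq J]

theorem unrollF_update {π : V} {y : BVar V J B} (hy : ∀ i b, y ≠ .x π i b)
    (w : BVar V J B → Bool) (c : Bool) :
    (unrollF 𝒦 code K π).eval (Function.update w y c) = true ↔
      (unrollF 𝒦 code K π).eval w = true := by
  have : ∀ i b, Function.update w y c (.x π i b) = w (.x π i b) :=
    fun i b => Function.update_of_ne (hy i b).symm _ _
  simp only [eval_unrollF, this]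

/-- The position variables are determined by the other ones. -/
theorem quantUpd_pos_iff (hpth : IsPathAssignment 𝒦 ps K pth d) {w : BVar V J B → Bool}
    (hcode : CodesPaths code ps K pth w) {P : (J → Trajectory V) → Prop}
    {f : PropForm (BVar V J B)}
    (hf : ∀ w', CodesPaths code ps K pth w' → PosCorrect ps ts K M w' →
      (f.eval w' = true ↔ P (boolTraj ps M w'))) :
    quantUpd (fun _ => True) ((posVars B ps ts K M ++ offVars B ps ts M).map fun x => (.ex, x))
        (fun w => (PropForm.and (phiPos ps ts K M (haltF 𝒦 code)) f).eval w = true) w ↔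
      P (boolTraj ps M w) := by
  rw [quantUpd_ex_block]
  simp only [implies_true, true_and, eval_and, Bool.and_eq_true]
  have key : ∀ w', (∀ x ∉ posVars B ps ts K M ++ offVars B ps ts M, w' x = w x) →
      CodesPaths code ps K pth w' ∧ boolTraj ps M w' = boolTraj ps M w := by
    refine fun w' h => ⟨fun π hπ i hi b => (h _ x_notMem).trans (hcode π hπ i hi b), ?_⟩
    funext τ n
    simp only [boolTraj, h _ t_notMem]
  have hpos : ∀ w', CodesPaths code ps K pth w' →
      ((phiPos ps ts K M (haltF 𝒦 code)).eval w' = true ↔ PosCorrect ps ts K M w') :=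
    fun w' h => eval_phiPos fun π hπ => (eval_haltF hpth h hπ le_rfl).2 (hpth.le π hπ)
  constructor
  · rintro ⟨w', hw', hp, hf'⟩
    obtain ⟨hc, hT⟩ := key w' hw'
    rw [← hT]
    exact (hf w' hc ((hpos w' hc).1 hp)).1 hf'
  · intro h
    obtain ⟨w', hw', hp⟩ := exists_posCorrect (ps := ps) (ts := ts) (K := K) (M := M) w
    obtain ⟨hc, hT⟩ := key w' hw'
    exact ⟨w', hw', (hpos w' hc).2 hp, (hf w' hc hp).2 (hT ▸ h)⟩

variable [∀ a, DecidablePred fun s => a ∈ 𝒦.label s]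

variable (𝒦 code ps K M) in
/-- The positions and the temporal formula. -/
def bodyF (mode : Mode) (φ : Formula AP V J) : PropForm (BVar V J B) :=
  .and (phiPos ps φ.trajs K M (haltF 𝒦 code))
    (enc ps K M (haltF 𝒦 code) φ.trajQs
      (ltlF ps φ.trajs K M (haltF 𝒦 code) (propF 𝒦 code) mode (φ.inner.toNNF true) 0))

/-- Correctness of the encoding for a fixed choice of paths. -/
theorem sat_iff_quantUpd_innerPrefix (hpth : IsPathAssignment 𝒦 ps K pth d)
    {A : Assignment AP V J} (hA : AssignsPaths 𝒦 ps pth A) (𝒯 : Set (Trace AP))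
    {φ : Formula AP V J} (hφ : φ.IsTrajPrefix) (hnd : φ.trajs.Nodup)
    (hvars : φ.inner.VarsIn ps φ.trajs) (hq : alternations (φ.trajQs.map Prod.fst) ≤ 1)
    (hM : K * ps.length * φ.trajs.length ≤ M) (mode : Mode) {v : BVar V J B → Bool}
    (hcode : CodesPaths code ps K pth v) :
    φ.Sat 𝒯 A ↔ quantUpd (fun _ => True) (innerPrefix B ps K M φ.trajQs φ.trajs)
      (fun w => (bodyF 𝒦 code ps K M mode φ).eval w = true) v := by
  obtain ⟨q, U₁, U₂, htq, henc⟩ :=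
    exists_blocks (ps := ps) (K := K) (M := M) (halt := haltF 𝒦 code) hq
  have hts : φ.trajs = U₁ ++ U₂ := by
    simp [Formula.trajs, htq, Function.comp_def]
  have hmem : ∀ τ ∈ φ.trajs, τ ∈ U₁ ∨ τ ∈ U₂ := fun τ hτ => by simpa [hts] using hτ
  have hU₁ : ∀ τ ∈ U₁, τ ∈ φ.trajs := fun τ hτ => by simp [hts, hτ]
  have hU₂ : ∀ τ ∈ U₂, τ ∈ φ.trajs := fun τ hτ => by simp [hts, hτ]
  have hU : ∀ τ ∈ U₁, τ ∉ U₂ := fun τ h₁ h₂ => (List.disjoint_of_nodup_append (hts ▸ hnd)) h₁ h₂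
  have hM' : K * ps.length * U₁.length + K * ps.length * U₂.length ≤ M := by
    rwa [hts, List.length_append, mul_add] at hM
  -- An assignment has the expected domain only if there is a trajectory variable at all; otherwise
  -- the prefix is empty and the domain plays no role.
  have hdom : ∀ F : (J → Option (Trajectory V)) → Prop,
      quantUpd (fun o => ∃ t ∈ fairTrajectories A.dom, o = some t) φ.trajQs F A.traj ↔
        quantUpd (fun o => ∃ t ∈ fairTrajectories {π | π ∈ ps}, o = some t) φ.trajQs F A.traj := by
    intro F
    rcases isEmpty_or_nonempty J with hJ | hJ
    · have : φ.trajQs = [] := List.eq_nil_iff_forall_not_mem.2 fun p _ => hJ.elim p.2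
      rw [this]
      rfl
    · rw [hA.dom_eq]
  set H : (J → Trajectory V) → Prop :=
    fun T => φ.inner.Holds (labelAt 𝒦 ps φ.trajs pth d T) 0 with hH
  have hHstutter : ∀ (e : ℕ → Prop) [DecidablePred e] (T T' : J → Trajectory V),
      {n | e n}.Infinite → (∀ τ, τ ∈ U₁ ∨ τ ∈ U₂ → ∀ π ∈ ps, ∀ n,
        position d (T τ) n π = position d (T' τ) (Nat.count e n) π) → (H T ↔ H T') :=
    fun e _ T T' he h => holds_labelAt_congr he fun τ hτ => h τ (hmem τ hτ)
  have hF : ∀ (G : J → Option (Trajectory V)) (T : J → Trajectory V),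
      (∀ τ, τ ∈ U₁ ∨ τ ∈ U₂ → G τ = some (T τ)) → (φ.inner.Sat ⟨A.trace, G⟩ ↔ H T) :=
    fun G T hGT => sat_iff_holds hpth (A := ⟨A.trace, G⟩) hA
      (fun τ hτ => hGT τ (hmem τ hτ)) hvars
  have hhalt : ∀ w : BVar V J B → Bool, (∀ j, Moves d ps (boolTraj ps M w) U₁ j) →
      (∀ j, AllHalted d ps (boolTraj ps M w) U₁ j → Moves d ps (boolTraj ps M w) U₂ j) →
      AllHalted d ps (boolTraj ps M w) φ.trajs M :=
    fun w => allHalted_of_moves_blocks hpth.le hmem hM'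
  have hcode' : ∀ w : BVar V J B → Bool, (∀ π i b, w (.x π i b) = v (.x π i b)) →
      CodesPaths code ps K pth w :=
    fun w h π hπ i hi b => (h π i b).trans (hcode π hπ i hi b)
  rw [Formula.sat_iff_quantUpd _ _ hφ, hdom, innerPrefix, quantUpd_append]
  cases q with
  | ex =>
    have hbody := fun (w : BVar V J B → Bool) (hw : ∀ π i b, w (.x π i b) = v (.x π i b)) =>
      quantUpd_pos_iff (ts := φ.trajs) (M := M) (P := fun T => (∀ j, Moves d ps T U₁ j) ∧
        ((∀ j, AllHalted d ps T U₁ j → Moves d ps T U₂ j) → H T)) hpth (hcode' w hw)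
        fun w' hc hp => (henc (ltlF ps φ.trajs K M (haltF 𝒦 code) (propF 𝒦 code) mode
          (φ.inner.toNNF true) 0) w').trans <| by
          simp only [eval_allMove hpth hc hp hU₁, eval_allMoveAfter hpth hc hp hU₁ hU₂]
          -- The temporal encoding is needed, and known to be exact, only under both move
          -- conditions, which force halting by `M`.
          exact and_congr_right fun h₁ => forall_congr' fun h₂ =>
            eval_ltlF_iff_holds hpth hc hp (hhalt w' h₁ h₂) mode hvars
    conv_rhs => rw [htq, flatMap_blocks]
    rw [htq]
    exact quantUpd_traj_iff hpth.le hU hM' hHstutter hF hbody A.traj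
  | all =>
    have hbody := fun (w : BVar V J B → Bool) (hw : ∀ π i b, w (.x π i b) = v (.x π i b)) =>
      quantUpd_pos_iff (ts := φ.trajs) (M := M) (P := fun T => (∀ j, Moves d ps T U₁ j) →
        ((∀ j, AllHalted d ps T U₁ j → Moves d ps T U₂ j) ∧ H T)) hpth (hcode' w hw)
        fun w' hc hp => (henc (ltlF ps φ.trajs K M (haltF 𝒦 code) (propF 𝒦 code) mode
          (φ.inner.toNNF true) 0) w').trans <| by
          simp only [eval_allMove hpth hc hp hU₁, eval_allMoveAfter hpth hc hp hU₁ hU₂]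
          exact forall_congr' fun h₁ => and_congr_right fun h₂ =>
            eval_ltlF_iff_holds hpth hc hp (hhalt w' h₁ h₂) mode hvars
    conv_rhs => rw [htq, flatMap_blocks]
    rw [htq]
    -- Negation turns `A⁺E⁺` into `E⁺A⁺` for the complement of `H`, and the matrix into the form
    -- required there.
    refine (quantUpd_all_ex_blocks _ _ _ _).trans
      (Iff.trans (not_congr ?_) (quantUpd_all_ex_blocks _ _ _ _).symm)
    refine quantUpd_traj_iff (H := fun T => ¬ H T) hpth.le hU hM'
      (fun e _ T T' he h => not_congr (hHstutter e T T' he h))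
      (fun G T h => not_congr (hF G T h)) (fun w hw => (not_congr (hbody w hw)).trans ?_) A.traj
    tauto

/-! ## The trace quantifiers -/

/-- The list `qs` holds the trace variables already quantified, for which paths are fixed and coded
by `v`. The full list `ps` stays fixed throughout, since the position and trajectory variables refer
to all paths. -/
theorem sat_iff_quantUpd_prefix (hK : 𝒦.IsMaxDepth K) (mode : Mode) (hps : ps.Nodup)
    {φ : Formula AP V J} (hφ : φ.IsPrenex) (hnd : φ.trajs.Nodup)
    (hvars : φ.inner.VarsIn ps φ.trajs) (hq : alternations (φ.trajQs.map Prod.fst) ≤ 1)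
    (hM : K * ps.length * φ.trajs.length ≤ M) {qs : List V} (hqs : ps = qs ++ φ.paths)
    (hpth : IsPathAssignment 𝒦 qs K pth d) {A : Assignment AP V J}
    (hA : AssignsPaths 𝒦 qs pth A) {v : BVar V J B → Bool} (hcode : CodesPaths code qs K pth v) :
    φ.Sat 𝒦.traces A ↔ quantUpd (fun _ => True)
      (outerPrefix V J B K φ.pathQs ++ innerPrefix B ps K M φ.trajQs φ.trajs)
      (fun w => (relativize 𝒦 code K φ.pathQs (bodyF 𝒦 code ps K M mode φ)).eval w = true) v := by
  induction φ generalizing qs pth d A v with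
  | body ψ =>
    obtain rfl : ps = qs := by simpa [Formula.paths, Formula.pathQs] using hqs
    exact sat_iff_quantUpd_innerPrefix hpth hA _ (φ := .body ψ) trivial hnd hvars hq hM mode hcode
  | traj q τ φ ih =>
    have hnil : ∀ φ : Formula AP V J, φ.IsTrajPrefix → φ.pathQs = [] := by
      intro φ hφ
      induction φ with
      | path => exact hφ.elim
      | traj q τ φ ih => exact ih hφ
      | body => rfl
    have hnil := hnil (.traj q τ φ) hφ
    obtain rfl : ps = qs := by simpa [Formula.paths, hnil] using hqs
    rw [hnil]
    exact sat_iff_quantUpd_innerPrefix hpth hA _ (φ := .traj q τ φ) hφ hnd hvars hq hM mode hcode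
  | path q π φ ih =>
    have hqs' : ps = (qs ++ [π]) ++ φ.paths := by simpa [Formula.paths, Formula.pathQs] using hqs
    have hnd' := hps
    rw [hqs'] at hnd'
    have hπ : π ∉ qs := fun h => List.disjoint_of_nodup_append hnd'.of_append_left h (by simp)
    have hπ' : π ∉ φ.pathQs.map Prod.snd := fun h =>
      List.disjoint_of_nodup_append hnd' (by simp) h
    set L := outerPrefix V J B K φ.pathQs ++ innerPrefix B ps K M φ.trajQs φ.trajs with hL
    set F : (BVar V J B → Bool) → Prop := fun w =>
      (relativize 𝒦 code K φ.pathQs (bodyF 𝒦 code ps K M mode φ)).eval w = true with hF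
    have hunroll : ∀ p ∈ L, ∀ (w : BVar V J B → Bool) c,
        (unrollF 𝒦 code K π).eval (Function.update w p.2 c) = true ↔
          (unrollF 𝒦 code K π).eval w = true :=
      fun p hp => unrollF_update (ne_x_of_mem_prefix hπ' hp)
    -- The induction hypothesis after choosing the path `p` for `π`. Since `π` is new, changing its
    -- bits does not disturb the codes of the earlier paths.
    have hIH : ∀ (p : ℕ → S) (w : BVar V J B → Bool), 𝒦.IsPath p →
        (∀ x ∉ xVars B V J K π, w x = v x) → (∀ i ≤ K, ∀ b, w (.x π i b) = code (p i) b) →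
        (φ.Sat 𝒦.traces (A.setTrace π fun i => 𝒦.label (p i)) ↔
          quantUpd (fun _ => True) L F w) := by
      intro p w hp hw hwp
      obtain ⟨dp, hdK, hdp⟩ := hK.exists_isDepth hp
      have hne : ∀ π' ∈ qs, π' ≠ π := fun π' h heq => hπ (heq ▸ h)
      have hor : ∀ π' ∈ qs ++ [π], π' ∈ qs ∨ π' = π := by simp
      refine ih hφ hnd hvars hq hM hqs' (pth := Function.update pth π p)
        (d := Function.update d π dp) ⟨fun π' h => ?_, fun π' h => ?_, fun π' h => ?_⟩
        (fun π' τ => ?_) fun π' h i hi b => ?_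
      · rcases hor π' h with h | rfl
        · simpa [hne π' h] using hpth.isPath π' h
        · simpa using hp
      · rcases hor π' h with h | rfl
        · simpa [hne π' h] using hpth.isDepth π' h
        · simpa using hdp
      · rcases hor π' h with h | rfl
        · simpa [hne π' h] using hpth.le π' h
        · simpa using hdK
      · by_cases h : π' = π
        · subst h
          simp [Assignment.setTrace]
        · simp [Assignment.setTrace, h, hA π' τ]
      · rcases hor π' h with h | rfl
        · rw [hw _ fun hx => ?_, hcode π' h i hi b, Function.update_of_ne (hne π' h)]
          obtain ⟨_, _, _, heq⟩ := mem_xVars.1 hx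
          cases heq
          exact hπ h
        · rw [hwp i hi b, Function.update_self]
    have hexists : ∀ p : ℕ → S, ∃ w : BVar V J B → Bool,
        (∀ x ∉ xVars B V J K π, w x = v x) ∧ ∀ i ≤ K, ∀ b, w (.x π i b) = code (p i) b := by
      refine fun p => ⟨fun x => if x ∈ xVars B V J K π then
        (match x with | .x _ i b => code (p i) b | _ => true) else v x,
        fun x hx => if_neg hx, fun i hi b => if_pos (mem_xVars.2 ⟨i, hi, b, rfl⟩)⟩
    have hprefix : ∀ q, outerPrefix V J B K ((q, π) :: φ.pathQs) ++
        innerPrefix B ps K M φ.trajQs φ.trajs =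
          (xVars B V J K π).map (fun x => (q, x)) ++ L := by
      intro q
      rw [hL, outerPrefix, List.flatMap_cons, List.append_assoc]
      rfl
    cases q with
    | ex =>
      simp only [Formula.Sat]
      refine Iff.trans ?_ (iff_of_eq (congrArg (fun L => quantUpd (fun _ => True) L
        (fun w => (PropForm.and (unrollF 𝒦 code K π) (relativize 𝒦 code K φ.pathQs
          (bodyF 𝒦 code ps K M mode φ))).eval w = true) v) (hprefix .ex))).symm
      rw [quantUpd_append, quantUpd_ex_block]
      simp only [eval_and, Bool.and_eq_true, implies_true, true_and]
      -- The unrolling of `π` stands in the matrix, below all later quantifiers. None of them binds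
      -- a state bit of `π`, so the guard can be moved directly behind the block for `π`, where it
      -- restricts the valuations to codes of paths.
      have hguard : ∀ w, quantUpd (fun _ => True) L
          (fun w => (unrollF 𝒦 code K π).eval w = true ∧ F w) w ↔
            ((unrollF 𝒦 code K π).eval w = true ∧ quantUpd (fun _ => True) L F w) :=
        fun w => quantUpd_and ⟨true, trivial⟩ L _ F w hunroll
      simp only [hF] at hguard
      simp only [hguard]
      simp only [eval_unrollF]
      constructor
      · rintro ⟨σ, ⟨p, hp, hσ⟩, h⟩
        obtain rfl : σ = fun i => 𝒦.label (p i) := funext hσ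
        obtain ⟨w, hw, hwp⟩ := hexists p
        exact ⟨w, hw, ⟨p, hp, hwp⟩, (hIH p w hp hw hwp).1 h⟩
      · rintro ⟨w, hw, ⟨p, hp, hwp⟩, h⟩
        exact ⟨_, ⟨p, hp, fun _ => rfl⟩, (hIH p w hp hw hwp).2 h⟩
    | all =>
      simp only [Formula.Sat]
      refine Iff.trans ?_ (iff_of_eq (congrArg (fun L => quantUpd (fun _ => True) L
        (fun w => (imp (unrollF 𝒦 code K π) (relativize 𝒦 code K φ.pathQs
          (bodyF 𝒦 code ps K M mode φ))).eval w = true) v) (hprefix .all))).symm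
      rw [quantUpd_append, quantUpd_all_block]
      simp only [eval_imp, implies_true, forall_const]
      have hguard : ∀ w, quantUpd (fun _ => True) L
          (fun w => (unrollF 𝒦 code K π).eval w = true → F w) w ↔
            ((unrollF 𝒦 code K π).eval w = true → quantUpd (fun _ => True) L F w) :=
        fun w => quantUpd_imp ⟨true, trivial⟩ L _ F w hunroll
      simp only [hF] at hguard
      simp only [hguard]
      simp only [eval_unrollF]
      constructor
      · rintro h w hw ⟨p, hp, hwp⟩
        exact (hIH p w hp hw hwp).1 (h _ ⟨p, hp, fun _ => rfl⟩)
      · rintro h σ ⟨p, hp, hσ⟩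
        obtain rfl : σ = fun i => 𝒦.label (p i) := funext hσ
        obtain ⟨w, hw, hwp⟩ := hexists p
        exact (hIH p w hp hw hwp).2 (h w hw ⟨p, hp, hwp⟩)

theorem eval_qbf (φ : Formula AP V J) (mode : Mode) (v : BVar V J B → Bool) :
    (qbf 𝒦 code φ mode K M).eval v = true ↔ quantUpd (fun _ => True)
      (outerPrefix V J B K φ.pathQs ++ innerPrefix B φ.paths K M φ.trajQs φ.trajs)
      (fun w => (relativize 𝒦 code K φ.pathQs
        (bodyF 𝒦 code φ.paths K M mode φ)).eval w = true) v := by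
  have happ : ∀ (l l' : List (Quant × BVar V J B)) (F : (BVar V J B → Bool) → Prop),
      quantUpd (fun _ => True) (l ++ l') F =
        quantUpd (fun _ => True) l (quantUpd (fun _ => True) l' F) :=
    fun l l' F => funext fun g => propext (quantUpd_append l l' F g)
  simp only [qbf, QBF.eval_foldr_block, QBF.eval_block, innerPrefix, outerPrefix, List.map_append,
    happ]
  rfl

theorem eval_qbf_iff_models (hK : 𝒦.IsMaxDepth K) {φ : Formula AP V J} (hwf : φ.WellFormed)
    (hpre : φ.IsPrenex) (hq : alternations (φ.trajQs.map Prod.fst) ≤ 1)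
    (hM : K * φ.paths.length * φ.trajs.length ≤ M) (mode : Mode) (v : BVar V J B → Bool) :
    (qbf 𝒦 code φ mode K M).eval v = true ↔ 𝒦.Models φ := by
  rw [eval_qbf]
  -- No trace variable is assigned yet, so the initial paths and depths are arbitrary placeholders.
  exact (sat_iff_quantUpd_prefix (qs := []) (pth := fun _ _ => 𝒦.init) (d := fun _ => 0) hK mode
    hwf.1 hpre hwf.2.1 hwf.2.2 hq hM rfl ⟨by simp, by simp, by simp⟩
    (fun π τ => by simp [Assignment.empty]) (fun π hπ => by simp at hπ)).symm

end Encoding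

end AHLTL

theorem mainTheorem1 {S AP V J B : Type*} [FinEnum S] [FinEnum B] [DecidableEq V] [DecidableEq J]
    (𝒦 : AHLTL.Kripke S AP) [DecidableRel 𝒦.rel] [∀ a, DecidablePred fun s => a ∈ 𝒦.label s]
    (code : S ↪ (B → Bool)) (h𝒦 : 𝒦.Acyclic)
    (φ : AHLTL.Formula AP V J) (hwf : φ.WellFormed) (hpre : φ.IsPrenex)
    (hq : AHLTL.alternations (φ.trajQs.map Prod.fst) ≤ 1)
    (K M : ℕ) (hK : 𝒦.IsMaxDepth K) (hM : M = K * φ.paths.length * φ.trajs.length) :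
    ((AHLTL.Encoding.qbf 𝒦 code φ .hpes K M).Satisfiable ↔ 𝒦.Models φ) ∧
      ((AHLTL.Encoding.qbf 𝒦 code φ .hopt K M).Satisfiable ↔ 𝒦.Models φ) := by
  -- The equivalence holds at every valuation, so satisfiability amounts to truth at any single one.
  have key := fun mode v => AHLTL.Encoding.eval_qbf_iff_models (code := code) hK hwf hpre hq hM.ge
    mode v
  exact ⟨⟨fun ⟨v, hv⟩ => (key _ v).1 hv, fun h => ⟨fun _ => false, (key _ _).2 h⟩⟩,
    ⟨fun ⟨v, hv⟩ => (key _ v).1 hv, fun h => ⟨fun _ => false, (key _ _).2 h⟩⟩⟩
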